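/- All graphs are finite, simple and undirected, and $\rho(G)$ denotes the spectral radius of $G$, i.e. the largest eigenvalue of its adjacency matrix. The gem $H_5$ is the graph obtained from a path on $4$ vertices by adding one new vertex adjacent to every vertex of the path; a graph is gem-free if it does not contain the gem as a (not necessarily induced) subgraph. Let $S_{n,k}$ be the graph of order $n$ obtained by joining every vertex of the complete graph $K_k$ to $n-k$ isolated vertices, and let $S_{n,k}^{t}$ be the graph of order $n$ obtained from $S_{n-t,k}$ by attaching $t$ pendant vertices to one vertex of maximum degree of $S_{n-t,k}$. **Theorem 1.2.** Let $m\ge 23$ be odd, and let $G$ be a gem-free graph with $m$ edges and without isolated vertices such that $G\not\cong S_{\frac{m+3}{2},2}$. Then $$\rho(G)\le \rho\bigl(S_{\frac{m+5}{2},2}^{2}\bigr),$$ and equality holds if and only if $G\cong S_{\frac{m+5}{2},2}^{2}$. Here $S_{\frac{m+5}{2},2}^{2}$ is $K_2$ joined to $\frac{m-3}{2}$ isolated vertices, plus two pendant vertices attached to a vertex of maximum degree (so it has $m$ edges). -/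

import Mathlib

/-- The join `G ∨ H`: the disjoint union of `G` and `H` together with all edges between them. -/
def graphJoin {V W : Type*} (G : SimpleGraph V) (H : SimpleGraph W) : SimpleGraph (V ⊕ W) :=
  SimpleGraph.sum G H ⊔ completeBipartiteGraph V W

/-- The graph obtained from `G` by attaching `t` pendant vertices to the vertex `v`. -/
def attachPendants {V : Type*} (G : SimpleGraph V) (v : V) (t : ℕ) : SimpleGraph (V ⊕ Fin t) :=
  SimpleGraph.sum G ⊥ ⊔ SimpleGraph.fromRel fun a b => a = Sum.inl v ∧ b.isRight = true

/-- The fan graph `H_n` (for `n ≥ 1`): a path on `n - 1` vertices together with one further vertex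
adjacent to every vertex of the path. -/
def fanGraph (n : ℕ) : SimpleGraph (Fin 1 ⊕ Fin (n - 1)) :=
  graphJoin ⊥ (SimpleGraph.pathGraph (n - 1))

/-- The gem `H_5`. -/
abbrev gemGraph : SimpleGraph (Fin 1 ⊕ Fin 4) := fanGraph 5

/-- The graph `S_{n,k}` (for `k ≤ n`), of order `n`: every vertex of the complete graph `K_k` is
joined to `n - k` isolated vertices. -/
def splitGraph (n k : ℕ) : SimpleGraph (Fin k ⊕ Fin (n - k)) :=
  graphJoin ⊤ ⊥

/-- The graph `S_{n,k}^t` (for `k ≥ 1` and `k + t ≤ n`), of order `n`: `t` pendant vertices are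
attached to a vertex of maximum degree of `S_{n-t,k}`. The vertices of `K_k` have maximum degree
there, and they are equivalent under automorphisms; the first of them is used. -/
def splitGraphPendant (n k t : ℕ) [NeZero k] :
    SimpleGraph ((Fin k ⊕ Fin (n - t - k)) ⊕ Fin t) :=
  attachPendants (splitGraph (n - t) k) (Sum.inl 0) t

open Classical in
/-- The spectral radius `ρ(G)` of a finite graph: the largest eigenvalue of its (real symmetric)
adjacency matrix. The set of eigenvalues is finite, and nonempty if `G` has a vertex. -/
noncomputable def graphSpectralRadius {V : Type*} [Fintype V] (G : SimpleGraph V) : ℝ :=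
  sSup {μ : ℝ | Module.End.HasEigenvalue (Matrix.toLin' (G.adjMatrix ℝ)) μ}

/-!
Let `ρ = ρ(G)`, and let `x ≥ 0` be an eigenvector for `ρ`, scaled so that its largest entry is
`x u = 1`. Write `N` for the neighbourhood of `u` and call the vertices outside `N ∪ {u}` far.
Summing the eigenvalue equations over `N` and comparing with the handshake formula gives
(`IsPeakVector.deficit`)

  `m - (ρ² - ρ) = ∑_{v ∈ N} (x v + d(v) (1/2 - x v)) + ∑_{w far} d(w) (1 - x w) + e(far)`,

where `d` counts neighbours in `N` and `e(far)` is the number of edges between far vertices. In a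
gem-free graph `N` contains no path on four vertices, so its components are triangles (contributing
`1 - x v` per vertex), isolated vertices (contributing `x v`) and stars; a star with `r ≥ 1` edges
and centre `c` contributes `1 + (r - 1) (1 - x c) ≥ 1`.

The spectral radius of the extremal graph is at least a root `l` of
`x⁴ - m x² - (m - 3) x + (m - 3)` with `l² - l > m - 2`. Hence, if `ρ` is at least the spectral
radius of the extremal graph, then the sum above is below `2`, and there is at most one star.

* Without a star, `N` consists of triangles and isolated vertices. A far vertex sees at most one
  vertex of each triangle, so its entry is bounded away from `1`, and summing the eigenvalue
  equations over the triangles gives a contradiction (`IsPeakVector.starSet_ne_empty`).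
* With one star, all the other contributions have sum below `1`. A triangle would then have
  entries that are too small (`IsPeakVector.triSet_eq_empty`), and far vertices have entries at
  most `2/5` (`IsPeakVector.far_le`), so there is at most one edge between `N` and the far
  vertices. As `m` is odd, such an edge would force an isolated vertex in `N`, and the two together
  contribute at least `1`; so there is no far vertex (`IsPeakVector.far_eq_empty`).

What remains is a star with `r` edges and `s` isolated vertices in `N`, with `s` even since
`m = 1 + 2 r + s`. The eigenvalue equations show that the quartic takes the value
`(2 - s) (ρ + r - 1)` at `ρ` (`IsPeakVector.extremalQuartic_eq`), whereas it is nonnegative from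
`l` on; so `s ≤ 2`. The case `s = 0` is the excluded graph, and `s = 2` is the extremal one.
-/

/-! ### The spectral radius and nonnegative eigenvectors -/

theorem bddAbove_hasEigenvalue_toLin' {V : Type*} [Fintype V] [DecidableEq V]
    (A : Matrix V V ℝ) : BddAbove {μ : ℝ | Module.End.HasEigenvalue (Matrix.toLin' A) μ} :=
  (Module.End.finite_hasEigenvalue _).bddAbove

theorem hasEigenvalue_toLin'_iff {V : Type*} [Fintype V] [DecidableEq V] (A : Matrix V V ℝ)
    (μ : ℝ) : Module.End.HasEigenvalue (Matrix.toLin' A) μ ↔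
      ∃ x : V → ℝ, x ≠ 0 ∧ A.mulVec x = μ • x := by
  constructor
  · intro h
    obtain ⟨x, hx⟩ := h.exists_hasEigenvector
    exact ⟨x, hx.2, by simpa using hx.apply_eq_smul⟩
  · rintro ⟨x, hx0, hx⟩
    exact Module.End.hasEigenvalue_of_hasEigenvector
      (Module.End.hasEigenvector_iff.2 ⟨Module.End.mem_eigenspace_iff.2 (by simpa using hx), hx0⟩)

open Classical in
theorem adjMatrix_mulVec_eq_sum {V : Type*} [Fintype V] (G : SimpleGraph V) (x : V → ℝ) (v : V) :
    (G.adjMatrix ℝ).mulVec x v = ∑ w, if G.Adj v w then x w else 0 := by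
  simp [Matrix.mulVec, dotProduct, SimpleGraph.adjMatrix_apply]

open Classical in
theorem le_graphSpectralRadius {V : Type*} [Fintype V] (G : SimpleGraph V) {μ : ℝ} {x : V → ℝ}
    (hx0 : x ≠ 0) (hx : ∀ v, (∑ w, if G.Adj v w then x w else 0) = μ * x v) :
    μ ≤ graphSpectralRadius G := by
  refine le_csSup (bddAbove_hasEigenvalue_toLin' _) ?_
  refine (hasEigenvalue_toLin'_iff _ _).2 ⟨x, hx0, ?_⟩
  ext v
  rw [adjMatrix_mulVec_eq_sum, hx v]
  rfl

open Classical in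
theorem exists_eigenvector_of_iso {V W : Type*} [Fintype V] [Fintype W] {G : SimpleGraph V}
    {H : SimpleGraph W} (f : G ≃g H) {μ : ℝ}
    (h : ∃ x : V → ℝ, x ≠ 0 ∧ (G.adjMatrix ℝ).mulVec x = μ • x) :
    ∃ x : W → ℝ, x ≠ 0 ∧ (H.adjMatrix ℝ).mulVec x = μ • x := by
  obtain ⟨x, hx0, hx⟩ := h
  refine ⟨x ∘ f.symm, fun h => hx0 ?_, ?_⟩
  · ext v
    simpa using congrFun h (f v)
  · ext w
    have := congrFun hx (f.symm w)
    rw [adjMatrix_mulVec_eq_sum] at this ⊢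
    rw [← f.toEquiv.sum_comp]
    simp only [Pi.smul_apply, Function.comp] at this ⊢
    rw [← this]
    refine Finset.sum_congr rfl fun v _ => ?_
    have h : H.Adj w (f v) ↔ G.Adj (f.symm w) v := by
      rw [← f.map_adj_iff]; simp
    simp [h]

open Classical in
theorem graphSpectralRadius_eq_of_iso {V W : Type*} [Fintype V] [Fintype W] {G : SimpleGraph V}
    {H : SimpleGraph W} (f : G ≃g H) :
    graphSpectralRadius G = graphSpectralRadius H := by
  unfold graphSpectralRadius
  congr 1
  ext μ
  simp only [Set.mem_ofPred_eq, hasEigenvalue_toLin'_iff]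
  exact ⟨exists_eigenvector_of_iso f, exists_eigenvector_of_iso f.symm⟩

open Classical in
theorem hasEigenvalue_sSup {V : Type*} [Fintype V] [Nonempty V] (A : Matrix V V ℝ)
    (hA : A.IsHermitian) :
    Module.End.HasEigenvalue (Matrix.toLin' A)
      (sSup {μ : ℝ | Module.End.HasEigenvalue (Matrix.toLin' A) μ}) := by
  have hne : {μ : ℝ | Module.End.HasEigenvalue (Matrix.toLin' A) μ}.Nonempty := by
    obtain ⟨i⟩ := ‹Nonempty V›
    refine ⟨hA.eigenvalues i, (hasEigenvalue_toLin'_iff _ _).2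
      ⟨(hA.eigenvectorBasis i).ofLp, ?_, hA.mulVec_eigenvectorBasis i⟩⟩
    intro h
    apply hA.eigenvectorBasis.toBasis.ne_zero i
    ext j
    simpa using congrFun h j
  exact hne.csSup_mem (Module.End.finite_hasEigenvalue _)

open Classical in
theorem posSemidef_sSup_smul_one_sub {V : Type*} [Fintype V] (A : Matrix V V ℝ)
    (hA : A.IsHermitian) :
    (sSup {μ : ℝ | Module.End.HasEigenvalue (Matrix.toLin' A) μ} • (1 : Matrix V V ℝ)
      - A).PosSemidef := by
  set ρ := sSup {μ : ℝ | Module.End.HasEigenvalue (Matrix.toLin' A) μ} with hρ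
  have hB : (ρ • (1 : Matrix V V ℝ) - A).IsHermitian := by
    refine Matrix.IsHermitian.sub ?_ hA
    simp [Matrix.IsHermitian]
  rw [hB.posSemidef_iff_eigenvalues_nonneg]
  intro i
  have h1 := hB.mulVec_eigenvectorBasis i
  have h2 : ρ - hB.eigenvalues i ≤ ρ := by
    refine le_csSup (bddAbove_hasEigenvalue_toLin' A) ((hasEigenvalue_toLin'_iff _ _).2
      ⟨(hB.eigenvectorBasis i).ofLp, ?_, ?_⟩)
    · intro h
      apply hB.eigenvectorBasis.toBasis.ne_zero i
      ext j
      simpa using congrFun h j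
    · rw [Matrix.sub_mulVec, Matrix.smul_mulVec, Matrix.one_mulVec] at h1
      rw [sub_smul, ← h1]; abel
  simpa using h2

open Classical in
/-- Perron's theorem in its weak form: passing to absolute values does not decrease the quadratic
form of the adjacency matrix, so it preserves the eigenvectors of the largest eigenvalue. -/
theorem exists_nonneg_eigenvector {V : Type*} [Fintype V] [Nonempty V] (G : SimpleGraph V) :
    ∃ x : V → ℝ, x ≠ 0 ∧ (∀ v, 0 ≤ x v) ∧
      (G.adjMatrix ℝ).mulVec x = graphSpectralRadius G • x := by
  set A := G.adjMatrix ℝ with hAdef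
  have hA : A.IsHermitian := by
    simp [Matrix.IsHermitian, Matrix.conjTranspose_eq_transpose_of_trivial, hAdef]
  obtain ⟨y, hy0, hy⟩ := (hasEigenvalue_toLin'_iff _ _).1 (hasEigenvalue_sSup A hA)
  have hP := posSemidef_sSup_smul_one_sub A hA
  change A.mulVec y = graphSpectralRadius G • y at hy
  change (graphSpectralRadius G • (1 : Matrix V V ℝ) - A).PosSemidef at hP
  set ρ := graphSpectralRadius G
  refine ⟨fun v => |y v|, ?_, fun v => abs_nonneg _, ?_⟩
  · intro h
    apply hy0
    ext v
    simpa using congrFun h v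
  · set z : V → ℝ := fun v => |y v| with hz
    have hq : ∀ x : V → ℝ, x ⬝ᵥ (ρ • (1 : Matrix V V ℝ) - A).mulVec x
        = ρ * ∑ v, x v * x v - ∑ v, ∑ w, A v w * (x v * x w) := by
      intro x
      rw [Matrix.sub_mulVec, Matrix.smul_mulVec, Matrix.one_mulVec, dotProduct_sub,
        dotProduct_smul]
      simp only [dotProduct, Matrix.mulVec, smul_eq_mul, Finset.mul_sum]
      congr 1
      refine Finset.sum_congr rfl fun v _ => Finset.sum_congr rfl fun w _ => by ring
    have h0 : y ⬝ᵥ (ρ • (1 : Matrix V V ℝ) - A).mulVec y = 0 := by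
      rw [Matrix.sub_mulVec, Matrix.smul_mulVec, Matrix.one_mulVec, hy]; simp
    have h1 : z ⬝ᵥ (ρ • (1 : Matrix V V ℝ) - A).mulVec z ≤ 0 := by
      rw [← h0, hq, hq]
      have : ∀ v, z v * z v = y v * y v := fun v => abs_mul_abs_self _
      simp only [this]
      refine sub_le_sub_left (Finset.sum_le_sum fun v _ => Finset.sum_le_sum fun w _ => ?_) _
      refine mul_le_mul_of_nonneg_left ?_ ?_
      · simp only [hz, ← abs_mul]; exact le_abs_self _
      · simp only [hAdef, SimpleGraph.adjMatrix_apply]; split_ifs <;> simp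
    have h2 := hP.dotProduct_mulVec_nonneg z
    have h3 := (hP.dotProduct_mulVec_zero_iff z).1 (le_antisymm (by simpa using h1) h2)
    rw [Matrix.sub_mulVec, Matrix.smul_mulVec, Matrix.one_mulVec] at h3
    exact (sub_eq_zero.1 h3).symm

/-- A Perron vector of `G` for `ρ`, scaled so that its largest entry, attained at `u`, is `1`. -/
structure IsPeakVector {V : Type*} [Fintype V] (G : SimpleGraph V) [DecidableRel G.Adj] (ρ : ℝ)
    (x : V → ℝ) (u : V) : Prop where
  nonneg : ∀ v, 0 ≤ x v
  le_one : ∀ v, x v ≤ 1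
  peak : x u = 1
  eig : ∀ v, ρ * x v = ∑ w, if G.Adj v w then x w else 0

open Classical in
theorem exists_isPeakVector {V : Type*} [Fintype V] [Nonempty V] (G : SimpleGraph V) :
    ∃ (x : V → ℝ) (u : V), IsPeakVector G (graphSpectralRadius G) x u := by
  obtain ⟨y, hy0, hy, hAy⟩ := exists_nonneg_eigenvector G
  obtain ⟨u, -, hu⟩ := Finset.exists_max_image Finset.univ y Finset.univ_nonempty
  have hpos : 0 < y u := by
    by_contra h
    apply hy0
    ext v
    exact le_antisymm ((hu v (Finset.mem_univ v)).trans (not_lt.1 h)) (hy v)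
  refine ⟨fun v => y v / y u, u, fun v => div_nonneg (hy v) hpos.le,
    fun v => (div_le_one hpos).2 (hu v (Finset.mem_univ v)), div_self hpos.ne', fun v => ?_⟩
  have h := congrFun hAy v
  rw [adjMatrix_mulVec_eq_sum] at h
  simp only [Pi.smul_apply, smul_eq_mul] at h
  rw [← mul_div_assoc, ← h, Finset.sum_div]
  refine Finset.sum_congr rfl fun w _ => ?_
  split_ifs <;> simp

/-! ### The quartic of the extremal graph -/

/-- The polynomial whose largest root is the spectral radius of `S_{(m+5)/2,2}^2`. -/
def extremalQuartic (m x : ℝ) : ℝ := x ^ 4 - m * x ^ 2 - (m - 3) * x + (m - 3)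

theorem exists_root_extremalQuartic {m : ℝ} (hm : 23 ≤ m) :
    ∃ l : ℝ, 5 < l ∧ m - 2 < l ^ 2 - l ∧ extremalQuartic m l = 0 := by
  -- The root lies just above the positive solution `a` of `a ^ 2 - a = m - 2`.
  set s := Real.sqrt (4 * m - 7) with hs
  have hs2 : s ^ 2 = 4 * m - 7 := Real.sq_sqrt (by linarith)
  have hs9 : 9 < s := Real.lt_sqrt_of_sq_lt (by linarith)
  set a := (1 + s) / 2 with ha
  have ha2 : a ^ 2 = a + m - 2 := by rw [ha]; nlinarith
  have ha5 : 5 < a := by rw [ha]; linarith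
  have hcont : ContinuousOn (extremalQuartic m) (Set.Icc a m) := by
    unfold extremalQuartic; fun_prop
  have ham : a ≤ m := by nlinarith
  have hneg : extremalQuartic m a < 0 := by
    have h : extremalQuartic m a = (a ^ 2 - a - (m - 1)) * (a ^ 2 + a) + 2 * a + m - 3 := by
      unfold extremalQuartic; ring
    rw [h, ha2]; ring_nf; nlinarith
  have hpos : 0 < extremalQuartic m m := by
    unfold extremalQuartic
    have : 0 < m ^ 2 * (m * (m - 1) - 1) := by
      apply mul_pos (by positivity); nlinarith
    nlinarith
  obtain ⟨l, hl, hl0⟩ := intermediate_value_Icc ham hcont ⟨hneg.le, hpos.le⟩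
  have hal : a < l := lt_of_le_of_ne hl.1 (by rintro rfl; linarith)
  exact ⟨l, by linarith, by nlinarith, hl0⟩

/-- Beyond a root in the relevant range the quartic is nonnegative. -/
theorem extremalQuartic_nonneg_of_root_le {m l y : ℝ} (hm : 23 ≤ m) (hl5 : 5 < l)
    (hl : m - 2 < l ^ 2 - l) (hl0 : extremalQuartic m l = 0) (hly : l ≤ y) :
    0 ≤ extremalQuartic m y := by
  have h : extremalQuartic m y - extremalQuartic m l
      = (y - l) * ((y + l) * (y ^ 2 + l ^ 2 - m) - (m - 3)) := by
    unfold extremalQuartic; ring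
  have h1 : m + 3 ≤ l ^ 2 := by linarith
  have h2 : l ^ 2 ≤ y ^ 2 := by nlinarith
  have h3 : 10 * (m + 6) ≤ (y + l) * (y ^ 2 + l ^ 2 - m) := by
    apply mul_le_mul <;> nlinarith
  have : 0 ≤ (y - l) * ((y + l) * (y ^ 2 + l ^ 2 - m) - (m - 3)) :=
    mul_nonneg (by linarith) (by linarith)
  linarith

theorem splitGraphPendant_adj {n k t : ℕ} [NeZero k]
    (a b : (Fin k ⊕ Fin (n - t - k)) ⊕ Fin t) :
    (splitGraphPendant n k t).Adj a b ↔
      match a, b with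
      | .inl (.inl i), .inl (.inl j) => i ≠ j
      | .inl (.inl _), .inl (.inr _) => True
      | .inl (.inr _), .inl (.inl _) => True
      | .inl (.inl i), .inr _ => i = 0
      | .inr _, .inl (.inl i) => i = 0
      | _, _ => False := by
  rcases a with (a | a) | a <;> rcases b with (b | b) | b <;>
    simp [splitGraphPendant, attachPendants, splitGraph, graphJoin]

theorem splitGraph_adj {n k : ℕ} (a b : Fin k ⊕ Fin (n - k)) :
    (splitGraph n k).Adj a b ↔
      match a, b with
      | .inl i, .inl j => i ≠ j
      | .inr _, .inr _ => False
      | _, _ => True := by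
  rcases a with a | a <;> rcases b with b | b <;> simp [splitGraph, graphJoin]

open Classical in
/-- A root of the quartic in the relevant range is an eigenvalue of `S_{(m+5)/2,2}^2`, hence at
most its spectral radius. -/
theorem root_le_graphSpectralRadius_splitGraphPendant {m r : ℕ} (hm : m = 2 * r + 3) {l : ℝ}
    (hl5 : 5 < l) (hl : (m : ℝ) - 2 < l ^ 2 - l) (hl0 : extremalQuartic m l = 0) :
    l ≤ graphSpectralRadius (splitGraphPendant ((m + 5) / 2) 2 2) := by
  have hr : (m + 5) / 2 - 2 - 2 = r := by omega
  have hmr : (m : ℝ) = 2 * r + 3 := by exact_mod_cast hm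
  have hden : 0 < l ^ 2 - r := by nlinarith [(Nat.cast_nonneg r : (0:ℝ) ≤ r)]
  have hl' : l ≠ 0 := by linarith
  -- `c` is the entry at the second dominating vertex when the one carrying the pendants has `1`.
  set c : ℝ := (l + r) / (l ^ 2 - r) with hc
  have hc1 : (l ^ 2 - r) * c = l + r := by rw [hc]; field_simp
  have hc2 : (l + r) * c = l ^ 2 - r - 2 := by
    rw [hc, ← mul_div_assoc, div_eq_iff hden.ne']
    unfold extremalQuartic at hl0
    rw [hmr] at hl0
    linear_combination -hl0
  refine le_graphSpectralRadius (splitGraphPendant ((m + 5) / 2) 2 2)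
    (x := Sum.elim (Sum.elim (fun i : Fin 2 => if i = 0 then 1 else c)
      fun _ => (1 + c) / l) fun _ => 1 / l) ?_ ?_
  · intro h
    simpa using congrFun h (Sum.inl (Sum.inl 0))
  · rintro ((i | i) | i)
    · fin_cases i
      · simp only [Fintype.sum_sum_type, splitGraphPendant_adj]
        simp [hr]
        field_simp
        linear_combination hc2
      · simp only [Fintype.sum_sum_type, splitGraphPendant_adj]
        simp [hr]
        field_simp
        linear_combination -hc1
    · simp only [Fintype.sum_sum_type, splitGraphPendant_adj]
      simp
      field_simp
    · simp only [Fintype.sum_sum_type, splitGraphPendant_adj]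
      simp
      field_simp

/-! ### Neighbourhoods in gem-free graphs -/

/-- In a gem-free graph no neighbourhood contains a path on four vertices. -/
theorem not_path_in_neighborhood {V : Type*} {G : SimpleGraph V} (hgem : gemGraph.Free G)
    {u a b c d : V} (ha : G.Adj u a) (hb : G.Adj u b) (hc : G.Adj u c) (hd : G.Adj u d)
    (hab : G.Adj a b) (hbc : G.Adj b c) (hcd : G.Adj c d) (hac : a ≠ c) (hbd : b ≠ d)
    (had : a ≠ d) : False := by
  have hne : (u ≠ a ∧ u ≠ b ∧ u ≠ c ∧ u ≠ d) ∧ a ≠ b ∧ b ≠ c ∧ c ≠ d :=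
    ⟨⟨ha.ne, hb.ne, hc.ne, hd.ne⟩, hab.ne, hbc.ne, hcd.ne⟩
  refine hgem ⟨⟨⟨Sum.elim (fun _ => u) ![a, b, c, d], ?_⟩, ?_⟩⟩
  · rintro (i | i) (j | j) hij
    · simp [fanGraph, graphJoin] at hij
    · fin_cases j <;> simp <;> assumption
    · fin_cases i <;> simp <;> apply SimpleGraph.Adj.symm <;> assumption
    · have hij : i.val + 1 = j.val ∨ j.val + 1 = i.val := by
        simpa [fanGraph, graphJoin, SimpleGraph.pathGraph_adj] using hij
      fin_cases i <;> fin_cases j <;> simp at hij ⊢ <;>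
        first | assumption | (apply SimpleGraph.Adj.symm; assumption)
  · rintro (i | i) (j | j) hij
    · simp [Subsingleton.elim i j]
    · exfalso
      fin_cases j <;> simp at hij <;> simp_all
    · exfalso
      fin_cases i <;> simp at hij <;> simp_all
    · fin_cases i <;> fin_cases j <;> simp at hij ⊢ <;> simp_all

section Peak

variable {V : Type*} [Fintype V] [DecidableEq V] {G : SimpleGraph V} [DecidableRel G.Adj]
  {ρ : ℝ} {x : V → ℝ} {u : V}

/-- The neighbourhood of `u`. -/
def near (G : SimpleGraph V) [DecidableRel G.Adj] (u : V) : Finset V := {v | G.Adj u v}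

/-- The vertices at distance at least two from `u`. -/
def far (G : SimpleGraph V) [DecidableRel G.Adj] (u : V) : Finset V := {w | w ≠ u ∧ ¬ G.Adj u w}

/-- The number of neighbours of `v` in `S`. -/
def degIn (G : SimpleGraph V) [DecidableRel G.Adj] (S : Finset V) (v : V) : ℕ :=
  (S.filter (G.Adj v)).card

omit [DecidableEq V] in
@[simp] theorem mem_near {v : V} : v ∈ near G u ↔ G.Adj u v := by simp [near]

@[simp] theorem mem_far {w : V} : w ∈ far G u ↔ w ≠ u ∧ ¬ G.Adj u w := by simp [far]

theorem sum_eq_near_add_far {M : Type*} [AddCommMonoid M] (G : SimpleGraph V)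
    [DecidableRel G.Adj] (u : V) (f : V → M) :
    ∑ v, f v = f u + ∑ v ∈ near G u, f v + ∑ v ∈ far G u, f v := by
  have h : (Finset.univ : Finset V) = insert u (near G u ∪ far G u) := by
    ext v
    simp only [Finset.mem_univ, Finset.mem_insert, Finset.mem_union, mem_near, mem_far, true_iff]
    tauto
  have hd : Disjoint (near G u) (far G u) := by
    rw [Finset.disjoint_left]; intro v hv hv'; simp_all
  rw [h, Finset.sum_insert (by simp), Finset.sum_union hd, add_assoc]

omit [DecidableEq V] [Fintype V] in
theorem cast_degIn (S : Finset V) (v : V) :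
    (degIn G S v : ℝ) = ∑ w ∈ S, if G.Adj v w then 1 else 0 := by
  simp [degIn]

omit [DecidableEq V] [Fintype V] in
theorem sum_adj_comm (A B : Finset V) (f : V → ℝ) :
    ∑ v ∈ A, ∑ w ∈ B, (if G.Adj v w then f w else 0) = ∑ w ∈ B, (degIn G A w : ℝ) * f w := by
  rw [Finset.sum_comm]
  refine Finset.sum_congr rfl fun w _ => ?_
  rw [cast_degIn, Finset.sum_mul]
  refine Finset.sum_congr rfl fun v _ => ?_
  simp [G.adj_comm v w]

omit [DecidableEq V] [Fintype V] in
theorem sum_adj_le_degIn (S : Finset V) (v : V) (hx : ∀ w, x w ≤ 1) :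
    ∑ w ∈ S, (if G.Adj v w then x w else 0) ≤ degIn G S v := by
  rw [cast_degIn]
  refine Finset.sum_le_sum fun w _ => ?_
  split_ifs
  · exact hx w
  · exact le_rfl

theorem IsPeakVector.eig_split (h : IsPeakVector G ρ x u) (v : V) :
    ρ * x v = (if G.Adj v u then 1 else 0) + ∑ w ∈ near G u, (if G.Adj v w then x w else 0)
      + ∑ w ∈ far G u, if G.Adj v w then x w else 0 := by
  rw [h.eig, sum_eq_near_add_far G u, h.peak]

omit [DecidableEq V] in
theorem IsPeakVector.sum_near (h : IsPeakVector G ρ x u) : ∑ v ∈ near G u, x v = ρ := by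
  have h1 := h.eig u
  rw [h.peak, mul_one] at h1
  rw [h1, near, Finset.sum_filter]

/-- The contribution of a neighbour `v` of `u` to `m - (ρ² - ρ)`. -/
noncomputable def charge (G : SimpleGraph V) [DecidableRel G.Adj] (u : V) (x : V → ℝ) (v : V) : ℝ :=
  x v + degIn G (near G u) v * (1 / 2 - x v)

/-- The contribution to `m - (ρ² - ρ)` of the edges between the neighbourhood of `u` and the
vertices far from `u`. -/
noncomputable def crossCost (G : SimpleGraph V) [DecidableRel G.Adj] (u : V) (x : V → ℝ) : ℝ :=
  ∑ w ∈ far G u, (degIn G (near G u) w : ℝ) * (1 - x w)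

/-- The number of edges among the vertices far from `u`, by the handshake formula. -/
noncomputable def farEdges (G : SimpleGraph V) [DecidableRel G.Adj] (u : V) : ℝ :=
  (∑ w ∈ far G u, (degIn G (far G u) w : ℝ)) / 2

theorem two_mul_card_edges (G : SimpleGraph V) [DecidableRel G.Adj] (u : V) :
    2 * G.edgeSet.ncard = 2 * (near G u).card + ∑ v ∈ near G u, degIn G (near G u) v
      + 2 * ∑ w ∈ far G u, degIn G (near G u) w + ∑ w ∈ far G u, degIn G (far G u) w := by
  have h1 : G.edgeSet.ncard = G.edgeFinset.card := by
    rw [Set.ncard_eq_toFinset_card']; rfl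
  have hdeg : ∀ v, G.degree v = (if G.Adj v u then 1 else 0) + degIn G (near G u) v
      + degIn G (far G u) v := by
    intro v
    rw [← SimpleGraph.card_neighborFinset_eq_degree, SimpleGraph.neighborFinset_eq_filter,
      Finset.card_filter, sum_eq_near_add_far G u, degIn, degIn, Finset.card_filter,
      Finset.card_filter]
  have hcomm : ∑ v ∈ near G u, degIn G (far G u) v = ∑ w ∈ far G u, degIn G (near G u) w := by
    simp only [degIn, Finset.card_filter]
    rw [Finset.sum_comm]
    simp only [G.adj_comm]
  have hu1 : G.degree u = (near G u).card := by
    rw [← SimpleGraph.card_neighborFinset_eq_degree, SimpleGraph.neighborFinset_eq_filter, near]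
  have hN : ∑ v ∈ near G u, (if G.Adj v u then 1 else 0) = (near G u).card := by
    rw [Finset.card_eq_sum_ones]
    refine Finset.sum_congr rfl fun v hv => ?_
    rw [if_pos (mem_near.1 hv).symm]
  have hW : ∑ v ∈ far G u, (if G.Adj v u then 1 else 0) = 0 := by
    refine Finset.sum_eq_zero fun v hv => ?_
    rw [if_neg fun h => (mem_far.1 hv).2 h.symm]
  rw [h1, ← G.sum_degrees_eq_twice_card_edges, sum_eq_near_add_far G u, hu1]
  simp only [hdeg, Finset.sum_add_distrib, hN, hW, hcomm]
  ring

theorem IsPeakVector.deficit (h : IsPeakVector G ρ x u) :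
    (G.edgeSet.ncard : ℝ) - (ρ ^ 2 - ρ)
      = ∑ v ∈ near G u, charge G u x v + crossCost G u x + farEdges G u := by
  have h1 : (2 * G.edgeSet.ncard : ℝ) = 2 * (near G u).card
      + ∑ v ∈ near G u, (degIn G (near G u) v : ℝ)
      + 2 * ∑ w ∈ far G u, (degIn G (near G u) w : ℝ)
      + ∑ w ∈ far G u, (degIn G (far G u) w : ℝ) := by
    exact_mod_cast two_mul_card_edges G u
  have h2 : ρ ^ 2 = (near G u).card + ∑ v ∈ near G u, (degIn G (near G u) v : ℝ) * x v
      + ∑ w ∈ far G u, (degIn G (near G u) w : ℝ) * x w := by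
    have hsum : ρ ^ 2 = ∑ v ∈ near G u, ρ * x v := by rw [← Finset.mul_sum, h.sum_near, sq]
    rw [hsum, Finset.sum_congr rfl fun v _ => h.eig_split v]
    rw [Finset.sum_add_distrib, Finset.sum_add_distrib, sum_adj_comm, sum_adj_comm]
    congr 2
    rw [Finset.card_eq_sum_ones, Nat.cast_sum]
    refine Finset.sum_congr rfl fun v hv => ?_
    rw [if_pos (mem_near.1 hv).symm, Nat.cast_one]
  have h3 : ∑ v ∈ near G u, charge G u x v = ρ
      + (∑ v ∈ near G u, (degIn G (near G u) v : ℝ)) / 2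
      - ∑ v ∈ near G u, (degIn G (near G u) v : ℝ) * x v := by
    rw [← h.sum_near, Finset.sum_div, ← Finset.sum_add_distrib, ← Finset.sum_sub_distrib]
    refine Finset.sum_congr rfl fun v _ => ?_
    rw [charge]; ring
  have h4 : crossCost G u x = ∑ w ∈ far G u, (degIn G (near G u) w : ℝ)
      - ∑ w ∈ far G u, (degIn G (near G u) w : ℝ) * x w := by
    rw [← Finset.sum_sub_distrib, crossCost]
    refine Finset.sum_congr rfl fun v _ => ?_
    ring
  rw [h3, h4, farEdges, h2]
  linarith

/-! ### Star components of a neighbourhood -/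

/-- `R` is a union of components of the graph induced on the neighbourhood of `u`, none of them an
isolated vertex or a triangle. In a gem-free graph such components are stars. -/
structure IsStarUnion (G : SimpleGraph V) [DecidableRel G.Adj] (u : V) (R : Finset V) : Prop where
  subset : ∀ v ∈ R, G.Adj u v
  closed : ∀ v ∈ R, ∀ w, G.Adj u w → G.Adj v w → w ∈ R
  exists_adj : ∀ v ∈ R, ∃ w, G.Adj u w ∧ G.Adj v w
  triangle_free : ∀ v ∈ R, ∀ a b, G.Adj u a → G.Adj u b → G.Adj v a → G.Adj v b → ¬ G.Adj a b

/-- The closed neighbourhood of `c` inside the neighbourhood of `u`. -/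
def starAt (G : SimpleGraph V) [DecidableRel G.Adj] (u c : V) : Finset V :=
  insert c ((near G u).filter (G.Adj c))

/-- `c` is the centre of a star component, with at least one edge, of the graph induced on the
neighbourhood of `u`. -/
structure IsStarCenter (G : SimpleGraph V) (u c : V) : Prop where
  adj : G.Adj u c
  exists_leaf : ∃ l, G.Adj u l ∧ G.Adj c l
  leaf : ∀ l, G.Adj u l → G.Adj c l → ∀ w, G.Adj u w → G.Adj l w → w = c

/-- If `v` is not a centre, then some neighbour `l` of `v` has a further neighbour. Such an `l` is a
centre: a neighbour of `l` with a neighbour other than `l` would complete a path on four vertices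
or a triangle. -/
theorem IsStarUnion.exists_center (hgem : gemGraph.Free G) {R : Finset V}
    (hR : IsStarUnion G u R) (hne : R.Nonempty) : ∃ c ∈ R, IsStarCenter G u c := by
  obtain ⟨v, hv⟩ := hne
  by_cases hc : IsStarCenter G u v
  · exact ⟨v, hv, hc⟩
  have huv := hR.subset v hv
  have : ∃ l, G.Adj u l ∧ G.Adj v l ∧ ∃ z, G.Adj u z ∧ G.Adj l z ∧ z ≠ v := by
    by_contra hcon
    push Not at hcon
    exact hc ⟨huv, hR.exists_adj v hv, hcon⟩
  obtain ⟨l, hul, hvl, z, huz, hlz, hzv⟩ := this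
  have hl := hR.closed v hv l hul hvl
  refine ⟨l, hl, hul, ⟨v, huv, hvl.symm⟩, fun y huy hly q huq hyq => ?_⟩
  by_contra hql
  by_cases hyv : y = v
  · subst hyv
    refine not_path_in_neighborhood hgem huq huy hul huz hyq.symm hvl hlz hql hzv.symm ?_
    rintro rfl
    exact hR.triangle_free l hl y q huy huq hvl.symm hlz hyq
  · refine not_path_in_neighborhood hgem huq huy hul huv hyq.symm hly.symm hvl.symm hql hyv ?_
    rintro rfl
    exact hR.triangle_free l hl y q huy huq hly hvl.symm hyq

theorem IsStarUnion.starAt_subset {R : Finset V} (hR : IsStarUnion G u R) {c : V} (hc : c ∈ R) :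
    starAt G u c ⊆ R := by
  intro v hv
  rw [starAt, Finset.mem_insert, Finset.mem_filter, mem_near] at hv
  rcases hv with rfl | ⟨h1, h2⟩
  · exact hc
  · exact hR.closed c hc v h1 h2

theorem IsStarUnion.sdiff_starAt {R : Finset V} (hR : IsStarUnion G u R) {c : V}
    (hcc : IsStarCenter G u c) : IsStarUnion G u (R \ starAt G u c) := by
  refine ⟨fun v hv => hR.subset v (Finset.mem_sdiff.1 hv).1, fun v hv w huw hvw => ?_,
    fun v hv => hR.exists_adj v (Finset.mem_sdiff.1 hv).1,
    fun v hv => hR.triangle_free v (Finset.mem_sdiff.1 hv).1⟩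
  obtain ⟨hvR, hvs⟩ := Finset.mem_sdiff.1 hv
  refine Finset.mem_sdiff.2 ⟨hR.closed v hvR w huw hvw, fun hw => hvs ?_⟩
  rw [starAt, Finset.mem_insert, Finset.mem_filter, mem_near] at hw ⊢
  rcases hw with rfl | ⟨-, h2⟩
  · exact Or.inr ⟨hR.subset v hvR, hvw.symm⟩
  · exact Or.inl (hcc.leaf w huw h2 v (hR.subset v hvR) hvw.symm)

omit [DecidableEq V] in
theorem IsStarCenter.degIn_leaf {c : V} (hc : IsStarCenter G u c) {l : V} (hul : G.Adj u l)
    (hcl : G.Adj c l) : degIn G (near G u) l = 1 := by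
  rw [degIn, Finset.card_eq_one]
  refine ⟨c, ?_⟩
  ext w
  rw [Finset.mem_filter, mem_near, Finset.mem_singleton]
  constructor
  · rintro ⟨h1, h2⟩; exact hc.leaf l hul hcl w h1 h2
  · rintro rfl; exact ⟨hc.adj, hcl.symm⟩

omit [DecidableEq V] in
theorem IsStarCenter.one_le_degIn {c : V} (hc : IsStarCenter G u c) :
    1 ≤ degIn G (near G u) c := by
  obtain ⟨l, h1, h2⟩ := hc.exists_leaf
  exact Finset.card_pos.2 ⟨l, by simp [h1, h2]⟩

theorem IsStarCenter.sum_charge {c : V} (hc : IsStarCenter G u c) :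
    ∑ v ∈ starAt G u c, charge G u x v
      = 1 + ((degIn G (near G u) c : ℝ) - 1) * (1 - x c) := by
  rw [starAt, Finset.sum_insert (by simp)]
  have : ∑ v ∈ (near G u).filter (G.Adj c), charge G u x v
      = ∑ v ∈ (near G u).filter (G.Adj c), (1 / 2 : ℝ) := by
    refine Finset.sum_congr rfl fun v hv => ?_
    rw [Finset.mem_filter, mem_near] at hv
    rw [charge, hc.degIn_leaf hv.1 hv.2]
    push_cast; ring
  rw [this, Finset.sum_const, nsmul_eq_mul]
  change charge G u x c + (degIn G (near G u) c : ℝ) * (1 / 2) = _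
  rw [charge]; ring

theorem IsStarCenter.one_le_sum_charge (hx : ∀ v, x v ≤ 1) {c : V} (hc : IsStarCenter G u c) :
    1 ≤ ∑ v ∈ starAt G u c, charge G u x v := by
  rw [hc.sum_charge]
  have h1 : (1 : ℝ) ≤ degIn G (near G u) c := by exact_mod_cast hc.one_le_degIn
  nlinarith [hx c]

theorem IsStarUnion.sum_charge_nonneg (hgem : gemGraph.Free G) (hx : ∀ v, x v ≤ 1)
    (R : Finset V) : IsStarUnion G u R → 0 ≤ ∑ v ∈ R, charge G u x v := by
  induction R using Finset.strongInduction with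
  | H R ih =>
    intro hR
    rcases R.eq_empty_or_nonempty with rfl | hne
    · simp
    obtain ⟨c, hcR, hc⟩ := hR.exists_center hgem hne
    have hsub := hR.starAt_subset hcR
    rw [← Finset.sum_sdiff hsub]
    have h1 := hc.one_le_sum_charge hx
    have h2 := ih _ (Finset.sdiff_ssubset hsub ⟨c, by simp [starAt]⟩) (hR.sdiff_starAt hc)
    linarith

/-- Every star component contributes at least `1`, so a total below `2` leaves room for one. -/
theorem IsStarUnion.eq_empty_or_eq_starAt (hgem : gemGraph.Free G) (hx : ∀ v, x v ≤ 1)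
    {R : Finset V} (hR : IsStarUnion G u R) (hlt : ∑ v ∈ R, charge G u x v < 2) :
    R = ∅ ∨ ∃ c, IsStarCenter G u c ∧ R = starAt G u c := by
  rcases R.eq_empty_or_nonempty with rfl | hne
  · exact Or.inl rfl
  obtain ⟨c, hcR, hc⟩ := hR.exists_center hgem hne
  have hsub := hR.starAt_subset hcR
  refine Or.inr ⟨c, hc, ?_⟩
  by_contra hneq
  have hR' := hR.sdiff_starAt hc
  have hne' : (R \ starAt G u c).Nonempty := by
    rw [Finset.sdiff_nonempty]
    exact fun h => hneq (h.antisymm hsub)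
  obtain ⟨c', hcR', hc'⟩ := hR'.exists_center hgem hne'
  have hsub' := hR'.starAt_subset hcR'
  rw [← Finset.sum_sdiff hsub, ← Finset.sum_sdiff hsub'] at hlt
  have h1 := hc.one_le_sum_charge hx
  have h2 := hc'.one_le_sum_charge hx
  have h3 := IsStarUnion.sum_charge_nonneg hgem hx _ (hR'.sdiff_starAt hc')
  linarith

/-! ### Triangle components of a neighbourhood -/

/-- `v`, `a`, `b` form a triangle inside the neighbourhood of `u`. -/
def IsTriangleAt (G : SimpleGraph V) (u v a b : V) : Prop :=
  G.Adj u v ∧ G.Adj u a ∧ G.Adj u b ∧ G.Adj v a ∧ G.Adj v b ∧ G.Adj a b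

omit [Fintype V] [DecidableEq V] [DecidableRel G.Adj] in
theorem IsTriangleAt.rotate {v a b : V} (h : IsTriangleAt G u v a b) : IsTriangleAt G u a b v :=
  ⟨h.2.1, h.2.2.1, h.1, h.2.2.2.2.2, h.2.2.2.1.symm, h.2.2.2.2.1.symm⟩

omit [Fintype V] [DecidableEq V] [DecidableRel G.Adj] in
theorem IsTriangleAt.eq_or_eq (hgem : gemGraph.Free G) {v a b y : V} (h : IsTriangleAt G u v a b)
    (huy : G.Adj u y) (hvy : G.Adj v y) : y = a ∨ y = b := by
  obtain ⟨hv, ha, hb, hva, hvb, hab⟩ := h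
  by_contra hcon
  push Not at hcon
  exact not_path_in_neighborhood hgem huy hv ha hb hvy.symm hva hab hcon.1 hvb.ne hcon.2

theorem IsTriangleAt.filter_near (hgem : gemGraph.Free G) {v a b : V}
    (h : IsTriangleAt G u v a b) : (near G u).filter (G.Adj v) = {a, b} := by
  ext y
  rw [Finset.mem_filter, mem_near, Finset.mem_insert, Finset.mem_singleton]
  constructor
  · rintro ⟨h1, h2⟩; exact h.eq_or_eq hgem h1 h2
  · rintro (rfl | rfl)
    · exact ⟨h.2.1, h.2.2.2.1⟩
    · exact ⟨h.2.2.1, h.2.2.2.2.1⟩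

theorem IsTriangleAt.degIn_near (hgem : gemGraph.Free G) {v a b : V}
    (h : IsTriangleAt G u v a b) : degIn G (near G u) v = 2 := by
  rw [degIn, h.filter_near hgem, Finset.card_pair h.2.2.2.2.2.ne]

/-- A vertex far from `u` sees at most one vertex of a triangle in the neighbourhood of `u`. -/
theorem IsTriangleAt.not_adj_far (hgem : gemGraph.Free G) {v a b w : V}
    (h : IsTriangleAt G u v a b) (hw : w ∈ far G u) (hwv : G.Adj w v) :
    ¬ G.Adj w a ∧ ¬ G.Adj w b := by
  obtain ⟨hv, ha, hb, hva, hvb, hab⟩ := h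
  obtain ⟨hwu, hnw⟩ := mem_far.1 hw
  constructor
  · intro hwa
    refine not_path_in_neighborhood hgem hwv.symm hva hv.symm hvb hwa ha.symm hb hwu hab.ne ?_
    rintro rfl
    exact hnw hb
  · intro hwb
    refine not_path_in_neighborhood hgem hwv.symm hvb hv.symm hva hwb hb.symm ha hwu hab.ne' ?_
    rintro rfl
    exact hnw ha

open Classical in
/-- The neighbours of `u` in a triangle of the neighbourhood of `u`. -/
noncomputable def triSet (G : SimpleGraph V) (u : V) : Finset V :=
  {v | ∃ a b, IsTriangleAt G u v a b}

open Classical in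
/-- The isolated vertices of the neighbourhood of `u`. -/
noncomputable def isoSet (G : SimpleGraph V) (u : V) : Finset V :=
  {v | G.Adj u v ∧ ∀ w, G.Adj u w → ¬ G.Adj v w}

/-- The vertices of the star components, with at least one edge, of the neighbourhood of `u`. -/
noncomputable def starSet (G : SimpleGraph V) [DecidableRel G.Adj] (u : V) : Finset V :=
  near G u \ (triSet G u ∪ isoSet G u)

omit [DecidableEq V] [DecidableRel G.Adj] in
theorem mem_triSet {v : V} : v ∈ triSet G u ↔ ∃ a b, IsTriangleAt G u v a b := by simp [triSet]

omit [DecidableEq V] [DecidableRel G.Adj] in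
theorem mem_isoSet {v : V} :
    v ∈ isoSet G u ↔ G.Adj u v ∧ ∀ w, G.Adj u w → ¬ G.Adj v w := by simp [isoSet]

theorem sum_near_eq (f : V → ℝ) : ∑ v ∈ near G u, f v
    = ∑ v ∈ triSet G u, f v + ∑ v ∈ isoSet G u, f v + ∑ v ∈ starSet G u, f v := by
  have hsub : triSet G u ∪ isoSet G u ⊆ near G u := by
    intro v hv
    rw [Finset.mem_union, mem_triSet, mem_isoSet] at hv
    rcases hv with ⟨a, b, h⟩ | h
    · exact mem_near.2 h.1
    · exact mem_near.2 h.1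
  have hd : Disjoint (triSet G u) (isoSet G u) := by
    rw [Finset.disjoint_left]
    intro v hv hv'
    obtain ⟨a, b, h⟩ := mem_triSet.1 hv
    exact (mem_isoSet.1 hv').2 a h.2.1 h.2.2.2.1
  rw [← Finset.sum_sdiff hsub, Finset.sum_union hd, starSet]
  ring

omit [DecidableEq V] [DecidableRel G.Adj] in
theorem adj_mem_triSet (hgem : gemGraph.Free G) {v w : V} (hv : v ∈ triSet G u)
    (huw : G.Adj u w) (hvw : G.Adj v w) : w ∈ triSet G u := by
  obtain ⟨a, b, h⟩ := mem_triSet.1 hv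
  rcases h.eq_or_eq hgem huw hvw with rfl | rfl
  · exact mem_triSet.2 ⟨_, _, h.rotate⟩
  · exact mem_triSet.2 ⟨_, _, h.rotate.rotate⟩

theorem isStarUnion_starSet (hgem : gemGraph.Free G) : IsStarUnion G u (starSet G u) := by
  have hmem : ∀ v, v ∈ starSet G u ↔ G.Adj u v ∧ v ∉ triSet G u ∧ v ∉ isoSet G u := by
    intro v; simp [starSet]
  refine ⟨fun v hv => ((hmem v).1 hv).1, fun v hv w huw hvw => ?_, fun v hv => ?_,
    fun v hv a b hua hub hva hvb hab => ?_⟩ <;> obtain ⟨h1, h2, h3⟩ := (hmem v).1 hv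
  · refine (hmem w).2 ⟨huw, fun hw => h2 (adj_mem_triSet hgem hw h1 hvw.symm), fun hw => ?_⟩
    exact (mem_isoSet.1 hw).2 v h1 hvw.symm
  · by_contra hcon
    push Not at hcon
    exact h3 (mem_isoSet.2 ⟨h1, hcon⟩)
  · exact h2 (mem_triSet.2 ⟨a, b, h1, hua, hub, hva, hvb, hab⟩)

omit [DecidableEq V] in
theorem degIn_near_of_mem_isoSet {v : V} (hv : v ∈ isoSet G u) : degIn G (near G u) v = 0 := by
  rw [degIn, Finset.card_eq_zero, Finset.filter_eq_empty_iff]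
  intro w hw
  exact (mem_isoSet.1 hv).2 w (mem_near.1 hw)

/-- A triangle vertex `v` contributes `1 - x v`, an isolated vertex `v` contributes `x v`. -/
theorem sum_charge_near (hgem : gemGraph.Free G) : ∑ v ∈ near G u, charge G u x v
    = ∑ v ∈ triSet G u, (1 - x v) + ∑ v ∈ isoSet G u, x v
      + ∑ v ∈ starSet G u, charge G u x v := by
  rw [sum_near_eq]
  congr 2
  · refine Finset.sum_congr rfl fun v hv => ?_
    obtain ⟨a, b, h⟩ := mem_triSet.1 hv
    rw [charge, h.degIn_near hgem]
    push_cast; ring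
  · refine Finset.sum_congr rfl fun v hv => ?_
    rw [charge, degIn_near_of_mem_isoSet hv]; simp

/-! ### Edges far from the peak -/

theorem degIn_far_le_farEdges {w : V} (hw : w ∈ far G u) :
    (degIn G (far G u) w : ℝ) ≤ farEdges G u := by
  have h : ∑ w' ∈ far G u, ((if w' = w then degIn G (far G u) w else 0)
      + if G.Adj w w' then 1 else 0) ≤ ∑ w' ∈ far G u, degIn G (far G u) w' := by
    refine Finset.sum_le_sum fun w' hw' => ?_
    by_cases hww : w' = w
    · subst hww; simp
    · rw [if_neg hww, zero_add]
      split_ifs with hadj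
      · exact Finset.card_pos.2 ⟨w, Finset.mem_filter.2 ⟨hw, hadj.symm⟩⟩
      · exact Nat.zero_le _
  rw [Finset.sum_add_distrib, Finset.sum_ite_eq' , if_pos hw, ← Finset.card_filter] at h
  change degIn G (far G u) w + degIn G (far G u) w ≤ _ at h
  have h' : (degIn G (far G u) w + degIn G (far G u) w : ℝ)
      ≤ ∑ w ∈ far G u, (degIn G (far G u) w : ℝ) := by exact_mod_cast h
  rw [farEdges]
  linarith

theorem farEdges_nonneg : 0 ≤ farEdges G u :=
  div_nonneg (Finset.sum_nonneg fun _ _ => Nat.cast_nonneg _) zero_le_two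

theorem crossCost_nonneg (hx : ∀ v, x v ≤ 1) : 0 ≤ crossCost G u x :=
  Finset.sum_nonneg fun w _ => mul_nonneg (Nat.cast_nonneg _) (by linarith [hx w])

theorem not_adj_of_farEdges_lt_one (h : farEdges G u < 1) {w w' : V} (hw : w ∈ far G u)
    (hw' : w' ∈ far G u) : ¬ G.Adj w w' := by
  intro hadj
  have h1 : 1 ≤ degIn G (far G u) w :=
    Finset.card_pos.2 ⟨w', Finset.mem_filter.2 ⟨hw', hadj⟩⟩
  have h2 : (1 : ℝ) ≤ degIn G (far G u) w := by exact_mod_cast h1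
  linarith [degIn_far_le_farEdges hw]

theorem IsPeakVector.eig_far (h : IsPeakVector G ρ x u) (hfar : farEdges G u < 1) {w : V}
    (hw : w ∈ far G u) : ρ * x w = ∑ v ∈ near G u, if G.Adj w v then x v else 0 := by
  rw [h.eig_split, if_neg fun h => (mem_far.1 hw).2 h.symm, zero_add, add_eq_left]
  refine Finset.sum_eq_zero fun w' hw' => ?_
  rw [if_neg (not_adj_of_farEdges_lt_one hfar hw hw')]

theorem IsPeakVector.mul_far_le_degIn (h : IsPeakVector G ρ x u) (hfar : farEdges G u < 1) {w : V}
    (hw : w ∈ far G u) : ρ * x w ≤ degIn G (near G u) w := by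
  rw [h.eig_far hfar hw]
  exact sum_adj_le_degIn _ _ h.le_one

/-- The neighbours of `u` that `w` misses account for the gap between `x w` and the peak. -/
theorem IsPeakVector.eig_far_gap (h : IsPeakVector G ρ x u) (hfar : farEdges G u < 1) {w : V}
    (hw : w ∈ far G u) :
    ρ * (1 - x w) = ∑ v ∈ near G u, if G.Adj w v then 0 else x v := by
  rw [mul_sub, mul_one, h.eig_far hfar hw, ← h.sum_near, ← Finset.sum_sub_distrib]
  refine Finset.sum_congr rfl fun v _ => ?_
  split_ifs <;> simp

theorem IsPeakVector.sum_le_gap (h : IsPeakVector G ρ x u) (hfar : farEdges G u < 1) {w : V}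
    (hw : w ∈ far G u) {S : Finset V} (hS : ∀ v ∈ S, G.Adj u v ∧ ¬ G.Adj w v) :
    ∑ v ∈ S, x v ≤ ρ * (1 - x w) := by
  rw [h.eig_far_gap hfar hw]
  have h1 : ∑ v ∈ S, x v = ∑ v ∈ S, if G.Adj w v then 0 else x v :=
    Finset.sum_congr rfl fun v hv => by rw [if_neg (hS v hv).2]
  rw [h1]
  refine Finset.sum_le_sum_of_subset_of_nonneg (fun v hv => mem_near.2 (hS v hv).1) fun v _ _ => ?_
  split_ifs
  · exact le_rfl
  · exact h.nonneg v

/-! ### A neighbourhood without star components -/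

omit [Fintype V] [DecidableEq V] in
theorem degIn_mono {S T : Finset V} (h : S ⊆ T) (v : V) : degIn G S v ≤ degIn G T v :=
  Finset.card_le_card (Finset.filter_subset_filter _ h)

omit [DecidableEq V] in
theorem triSet_subset_near : triSet G u ⊆ near G u := fun v hv => by
  obtain ⟨a, b, h⟩ := mem_triSet.1 hv
  exact mem_near.2 h.1

theorem card_starAt_of_mem_triSet (hgem : gemGraph.Free G) {v : V} (hv : v ∈ triSet G u) :
    (starAt G u v).card = 3 := by
  obtain ⟨a, b, h⟩ := mem_triSet.1 hv
  rw [starAt, Finset.card_insert_of_notMem (by simp)]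
  have := h.degIn_near hgem
  rw [degIn] at this
  rw [this]

theorem starAt_subset_triSet (hgem : gemGraph.Free G) {v : V} (hv : v ∈ triSet G u) :
    starAt G u v ⊆ triSet G u := by
  intro y hy
  rw [starAt, Finset.mem_insert, Finset.mem_filter, mem_near] at hy
  rcases hy with rfl | ⟨h1, h2⟩
  · exact hv
  · exact adj_mem_triSet hgem hv h1 h2

/-- A vertex far from `u` sees at most one vertex of each triangle. -/
theorem three_mul_degIn_triSet_le (hgem : gemGraph.Free G) {w : V} (hw : w ∈ far G u) :
    3 * degIn G (triSet G u) w ≤ (triSet G u).card := by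
  set s := (triSet G u).filter (G.Adj w) with hs
  have hmem : ∀ v ∈ s, v ∈ triSet G u ∧ G.Adj w v := fun v hv => Finset.mem_filter.1 hv
  have hnadj : ∀ v ∈ s, ∀ v' ∈ s, ¬ G.Adj v v' := by
    intro v hv v' hv' hadj
    obtain ⟨a, b, h⟩ := mem_triSet.1 (hmem v hv).1
    have h1 := h.not_adj_far hgem hw (hmem v hv).2
    rcases h.eq_or_eq hgem (mem_near.1 (triSet_subset_near (hmem v' hv').1)) hadj with rfl | rfl
    · exact h1.1 (hmem _ hv').2
    · exact h1.2 (hmem _ hv').2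
  have hdisj : (s : Set V).PairwiseDisjoint (starAt G u) := by
    intro v hv v' hv' hne
    rw [Function.onFun, Finset.disjoint_left]
    intro z hz hz'
    have hzt := starAt_subset_triSet hgem (hmem v hv).1 hz
    rw [starAt, Finset.mem_insert, Finset.mem_filter, mem_near] at hz hz'
    rcases hz with rfl | ⟨huz, hvz⟩
    · rcases hz' with rfl | ⟨-, h⟩
      · exact hne rfl
      · exact hnadj _ hv' _ hv h
    · rcases hz' with rfl | ⟨-, hvz'⟩
      · exact hnadj _ hv _ hv' hvz
      · obtain ⟨a, b, h⟩ := mem_triSet.1 hzt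
        have h1 := h.eq_or_eq hgem (mem_near.1 (triSet_subset_near (hmem v hv).1)) hvz.symm
        have h2 := h.eq_or_eq hgem (mem_near.1 (triSet_subset_near (hmem v' hv').1)) hvz'.symm
        have hab := h.2.2.2.2.2
        rcases h1 with rfl | rfl <;> rcases h2 with rfl | rfl
        · exact hne rfl
        · exact hnadj _ hv _ hv' hab
        · exact hnadj _ hv' _ hv hab
        · exact hne rfl
  have hcard := Finset.card_biUnion hdisj
  rw [Finset.sum_congr rfl fun v hv => card_starAt_of_mem_triSet hgem (hmem v hv).1,
    Finset.sum_const, smul_eq_mul] at hcard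
  have hsub : s.biUnion (starAt G u) ⊆ triSet G u :=
    Finset.biUnion_subset.2 fun v hv => starAt_subset_triSet hgem (hmem v hv).1
  have := Finset.card_le_card hsub
  rw [degIn, ← hs]
  omega

/-- Summing the eigenvalue equation over the triangles. -/
theorem IsPeakVector.sum_triSet (h : IsPeakVector G ρ x u) (hgem : gemGraph.Free G) :
    (ρ - 2) * ∑ v ∈ triSet G u, x v
      = (triSet G u).card + ∑ w ∈ far G u, (degIn G (triSet G u) w : ℝ) * x w := by
  have h1 : ∑ v ∈ triSet G u, ρ * x v = (triSet G u).card
      + ∑ w ∈ near G u, (degIn G (triSet G u) w : ℝ) * x w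
      + ∑ w ∈ far G u, (degIn G (triSet G u) w : ℝ) * x w := by
    rw [Finset.sum_congr rfl fun v _ => h.eig_split v, Finset.sum_add_distrib,
      Finset.sum_add_distrib, sum_adj_comm, sum_adj_comm]
    congr 2
    rw [Finset.card_eq_sum_ones, Nat.cast_sum]
    refine Finset.sum_congr rfl fun v hv => ?_
    rw [if_pos (mem_near.1 (triSet_subset_near hv)).symm, Nat.cast_one]
  have h2 : ∑ w ∈ near G u, (degIn G (triSet G u) w : ℝ) * x w
      = 2 * ∑ v ∈ triSet G u, x v := by
    rw [← Finset.sum_subset triSet_subset_near, Finset.mul_sum]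
    · refine Finset.sum_congr rfl fun w hw => ?_
      obtain ⟨a, b, ht⟩ := mem_triSet.1 hw
      have : degIn G (triSet G u) w = 2 := by
        rw [← ht.degIn_near hgem, degIn, degIn]
        congr 1
        ext y
        rw [Finset.mem_filter, Finset.mem_filter]
        exact ⟨fun hy => ⟨triSet_subset_near hy.1, hy.2⟩,
          fun hy => ⟨adj_mem_triSet hgem hw (mem_near.1 hy.1) hy.2, hy.2⟩⟩
      rw [this]; push_cast; ring
    · intro w hw hwt
      have : degIn G (triSet G u) w = 0 := by
        rw [degIn, Finset.card_eq_zero, Finset.filter_eq_empty_iff]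
        intro y hy hadj
        exact hwt (adj_mem_triSet hgem hy (mem_near.1 hw) hadj.symm)
      rw [this]; simp
  rw [← Finset.mul_sum, h2] at h1
  linarith

/-- The neighbourhood of the peak cannot consist of triangles and isolated vertices only. -/
theorem IsPeakVector.starSet_ne_empty (h : IsPeakVector G ρ x u) (hgem : gemGraph.Free G)
    (hρ : 5 < ρ)
    (hlt : ∑ v ∈ triSet G u, (1 - x v) + ∑ v ∈ isoSet G u, x v + crossCost G u x + farEdges G u
      < 2) : starSet G u ≠ ∅ := by
  intro hstar
  have hsum := h.sum_near
  rw [sum_near_eq, hstar, Finset.sum_empty, add_zero] at hsum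
  have ha : 0 ≤ ∑ v ∈ triSet G u, (1 - x v) :=
    Finset.sum_nonneg fun v _ => by linarith [h.le_one v]
  have haS : ∑ v ∈ triSet G u, (1 - x v) = (triSet G u).card - ∑ v ∈ triSet G u, x v := by
    simp
  have hb : 0 ≤ ∑ v ∈ isoSet G u, x v := Finset.sum_nonneg fun v _ => h.nonneg v
  have hc : 0 ≤ farEdges G u := farEdges_nonneg
  have he : 0 ≤ crossCost G u x := crossCost_nonneg h.le_one
  rcases (triSet G u).eq_empty_or_nonempty with hT | ⟨v, hv⟩
  · rw [hT] at hsum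
    simp only [Finset.sum_empty] at hsum
    linarith
  -- `k` is the number of triangles; only `3 * k ≤ card` is needed.
  set k := (triSet G u).card / 3 with hk
  have hk1 : 1 ≤ k := by
    have h1 := Finset.card_le_card (starAt_subset_triSet hgem hv)
    rw [card_starAt_of_mem_triSet hgem hv] at h1
    omega
  have hkT : 3 * k ≤ (triSet G u).card := Nat.mul_div_le _ _
  have hk1' : (1 : ℝ) ≤ k := by exact_mod_cast hk1
  have hkT' : (3 * k : ℝ) ≤ (triSet G u).card := by exact_mod_cast hkT
  -- The entries near `u` sum to `ρ`, and those on triangles fall short of `1` by less than `2` in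
  -- total, so `3 * k - 2 < ρ`; this suffices for `3 ≤ k`, and `5 < ρ` for `k ≤ 2`.
  have hρk : (k : ℝ) + 3 ≤ ρ := by
    rcases Nat.lt_or_ge 2 k with hk3 | hk3
    · have : (3 : ℝ) ≤ k := by exact_mod_cast hk3
      linarith
    · have : (k : ℝ) ≤ 2 := by exact_mod_cast hk3
      linarith
  have hfar : ∑ w ∈ far G u, (degIn G (triSet G u) w : ℝ) * x w
      ≤ (k + 2) * crossCost G u x := by
    rw [crossCost, Finset.mul_sum]
    refine Finset.sum_le_sum fun w hw => ?_
    have hd : degIn G (triSet G u) w ≤ k := by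
      have := three_mul_degIn_triSet_le hgem hw
      omega
    have hd' : (degIn G (triSet G u) w : ℝ) ≤ k := by exact_mod_cast hd
    have hxw : ρ * x w ≤ k + 2 := by
      have h1 := h.eig_split w
      rw [if_neg fun h => (mem_far.1 hw).2 h.symm, sum_near_eq, hstar, Finset.sum_empty] at h1
      have h2 := sum_adj_le_degIn (G := G) (triSet G u) w h.le_one
      have h3 := (sum_adj_le_degIn (G := G) (far G u) w h.le_one).trans
        (degIn_far_le_farEdges hw)
      have h4 : ∑ v ∈ isoSet G u, (if G.Adj w v then x v else 0) ≤ ∑ v ∈ isoSet G u, x v := by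
        refine Finset.sum_le_sum fun v _ => ?_
        split_ifs
        · exact le_rfl
        · exact h.nonneg v
      linarith
    have hxw' : x w ≤ (k + 2) * (1 - x w) := by nlinarith [h.nonneg w]
    have hmono : (degIn G (triSet G u) w : ℝ) ≤ degIn G (near G u) w := by
      exact_mod_cast degIn_mono triSet_subset_near w
    calc (degIn G (triSet G u) w : ℝ) * x w
        ≤ degIn G (near G u) w * ((k + 2) * (1 - x w)) := by
          apply mul_le_mul hmono hxw' (h.nonneg w) (Nat.cast_nonneg _)
      _ = _ := by ring
  have hS := h.sum_triSet hgem
  set a := ∑ v ∈ triSet G u, (1 - x v)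
  set S := ∑ v ∈ triSet G u, x v
  set e := crossCost G u x
  have hSa : S = (triSet G u).card - a := by linarith
  have hmain : (3 * k : ℝ) * (ρ - 3) ≤ (ρ - 2) * a + (k + 2) * e := by
    have : (3 * k : ℝ) * (ρ - 3) ≤ (triSet G u).card * (ρ - 3) :=
      mul_le_mul_of_nonneg_right hkT' (by linarith)
    rw [hSa] at hS
    linarith
  -- `a + e < 2` bounds the right-hand side by twice the larger of the two coefficients.
  rcases le_total ((k : ℝ) + 2) (ρ - 2) with hle | hle
  · have h1 : (k + 2) * e ≤ (ρ - 2) * e := mul_le_mul_of_nonneg_right hle he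
    have h2 : (ρ - 2) * (a + e) < (ρ - 2) * 2 :=
      mul_lt_mul_of_pos_left (by linarith) (by linarith)
    nlinarith
  · have h1 : (ρ - 2) * a ≤ (k + 2) * a := mul_le_mul_of_nonneg_right hle ha
    have h2 : ((k : ℝ) + 2) * (a + e) < (k + 2) * 2 :=
      mul_lt_mul_of_pos_left (by linarith) (by linarith)
    nlinarith

/-! ### No triangles next to a star component -/

/-- A far neighbour `w` of the triangle vertex `v` misses `a` and `b`, hence `ρ (1 - x w) ≥ 1`, and
its entry is at most its contribution to `crossCost`. -/
theorem IsPeakVector.mul_le_of_isTriangleAt (h : IsPeakVector G ρ x u) (hgem : gemGraph.Free G)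
    (hfar : farEdges G u < 1) {v a b : V} (ht : IsTriangleAt G u v a b)
    (hab : 1 ≤ x a + x b) : ρ * x v ≤ 3 + crossCost G u x := by
  rw [h.eig_split, if_pos ht.1.symm, ← Finset.sum_filter, ht.filter_near hgem,
    Finset.sum_pair ht.2.2.2.2.2.ne]
  have h1 : ∑ w ∈ far G u, (if G.Adj v w then x w else 0) ≤ crossCost G u x := by
    refine Finset.sum_le_sum fun w hw => ?_
    split_ifs with hadj
    · have h2 := ht.not_adj_far hgem hw hadj.symm
      have h3 := h.sum_le_gap hfar hw (S := {a, b}) (by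
        intro y hy
        rw [Finset.mem_insert, Finset.mem_singleton] at hy
        rcases hy with rfl | rfl
        · exact ⟨ht.2.1, h2.1⟩
        · exact ⟨ht.2.2.1, h2.2⟩)
      rw [Finset.sum_pair ht.2.2.2.2.2.ne] at h3
      have h4 := h.mul_far_le_degIn hfar hw
      have h5 : ρ * x w * (1 - x w) ≤ degIn G (near G u) w * (1 - x w) :=
        mul_le_mul_of_nonneg_right h4 (by linarith [h.le_one w])
      have h6 : x w * 1 ≤ x w * (ρ * (1 - x w)) :=
        mul_le_mul_of_nonneg_left (by linarith) (h.nonneg w)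
      linarith
    · exact mul_nonneg (Nat.cast_nonneg _) (by linarith [h.le_one w])
  linarith [h.le_one a, h.le_one b]

theorem IsPeakVector.triSet_eq_empty (h : IsPeakVector G ρ x u) (hgem : gemGraph.Free G)
    (hρ : 5 < ρ) (hfar : farEdges G u < 1)
    (hlt : ∑ v ∈ triSet G u, (1 - x v) + crossCost G u x < 1) : triSet G u = ∅ := by
  by_contra hne
  obtain ⟨v, hv⟩ := Finset.nonempty_iff_ne_empty.2 hne
  obtain ⟨a, b, ht⟩ := mem_triSet.1 hv
  have he : 0 ≤ crossCost G u x := crossCost_nonneg h.le_one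
  have hsub : ({v, a, b} : Finset V) ⊆ triSet G u := by
    intro y hy
    simp only [Finset.mem_insert, Finset.mem_singleton] at hy
    rcases hy with rfl | rfl | rfl
    · exact hv
    · exact mem_triSet.2 ⟨_, _, ht.rotate⟩
    · exact mem_triSet.2 ⟨_, _, ht.rotate.rotate⟩
  have hsum := Finset.sum_le_sum_of_subset_of_nonneg (f := fun v => 1 - x v) hsub
    fun y _ _ => by linarith [h.le_one y]
  rw [Finset.sum_insert (by simp [ht.2.2.2.1.ne, ht.2.2.2.2.1.ne]),
    Finset.sum_pair ht.2.2.2.2.2.ne] at hsum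
  have hv1 := h.le_one v
  have ha1 := h.le_one a
  have hb1 := h.le_one b
  have h1 := h.mul_le_of_isTriangleAt hgem hfar ht (by linarith)
  have h2 := h.mul_le_of_isTriangleAt hgem hfar ht.rotate (by linarith)
  have h3 := h.mul_le_of_isTriangleAt hgem hfar ht.rotate.rotate (by linarith)
  have h4 : 5 * (x v + x a + x b) ≤ ρ * (x v + x a + x b) :=
    mul_le_mul_of_nonneg_right hρ.le (by linarith)
  linarith

/-! ### A single star component -/

variable {c : V}

/-- The neighbours of `c` in the neighbourhood of `u`. -/
def leaves (G : SimpleGraph V) [DecidableRel G.Adj] (u c : V) : Finset V :=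
  (near G u).filter (G.Adj c)

omit [DecidableEq V] in
theorem mem_leaves {l : V} : l ∈ leaves G u c ↔ G.Adj u l ∧ G.Adj c l := by simp [leaves]

omit [DecidableEq V] in
theorem card_leaves : (leaves G u c).card = degIn G (near G u) c := rfl

/-- The neighbourhood of `u` consists of one star component with centre `c` and of isolated
vertices. -/
structure IsSingleStar (G : SimpleGraph V) [DecidableRel G.Adj] (u c : V) : Prop where
  center : IsStarCenter G u c
  triSet_eq : triSet G u = ∅
  starSet_eq : starSet G u = starAt G u c

theorem IsSingleStar.sum_near (hs : IsSingleStar G u c) {M : Type*} [AddCommMonoid M]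
    (f : V → M) :
    ∑ v ∈ near G u, f v = f c + ∑ v ∈ leaves G u c, f v + ∑ v ∈ isoSet G u, f v := by
  have h1 : near G u = starAt G u c ∪ isoSet G u := by
    have h : isoSet G u ⊆ near G u := fun v hv => mem_near.2 (mem_isoSet.1 hv).1
    rw [← hs.starSet_eq, starSet, hs.triSet_eq, Finset.empty_union, Finset.sdiff_union_of_subset h]
  have hd : Disjoint (starAt G u c) (isoSet G u) := by
    rw [← hs.starSet_eq, starSet, hs.triSet_eq, Finset.empty_union]
    exact Finset.sdiff_disjoint
  rw [h1, Finset.sum_union hd, starAt, Finset.sum_insert (by simp), leaves]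

theorem IsSingleStar.mem_near_iff (hs : IsSingleStar G u c) {v : V} :
    G.Adj u v ↔ v = c ∨ v ∈ leaves G u c ∨ v ∈ isoSet G u := by
  have h : v ∈ near G u ↔ v ∈ starSet G u ∨ v ∈ isoSet G u := by
    rw [starSet, hs.triSet_eq, Finset.empty_union, Finset.mem_sdiff]
    have := fun h : v ∈ isoSet G u => mem_near.2 (mem_isoSet.1 h).1
    tauto
  rw [← mem_near, h, hs.starSet_eq, starAt, Finset.mem_insert, leaves, or_assoc]

/-- The edge count of a graph whose peak neighbourhood is a star with isolated vertices. -/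
theorem IsSingleStar.card_edges (hs : IsSingleStar G u c) (hfar : farEdges G u < 1) :
    G.edgeSet.ncard = 1 + 2 * (leaves G u c).card + (isoSet G u).card
      + ∑ w ∈ far G u, degIn G (near G u) w := by
  have h := two_mul_card_edges G u
  have h0 : ∑ w ∈ far G u, degIn G (far G u) w = 0 := by
    refine Finset.sum_eq_zero fun w hw => ?_
    rw [degIn, Finset.card_eq_zero, Finset.filter_eq_empty_iff]
    intro w' hw'
    exact not_adj_of_farEdges_lt_one hfar hw hw'
  have h1 : (near G u).card = 1 + (leaves G u c).card + (isoSet G u).card := by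
    simp only [Finset.card_eq_sum_ones]
    exact hs.sum_near _
  have h2 : ∑ v ∈ near G u, degIn G (near G u) v = 2 * (leaves G u c).card := by
    rw [hs.sum_near, Finset.sum_congr rfl fun v hv => degIn_near_of_mem_isoSet hv,
      Finset.sum_congr rfl fun l hl =>
        hs.center.degIn_leaf (mem_leaves.1 hl).1 (mem_leaves.1 hl).2, ← card_leaves]
    simp
    ring
  rw [h0, h1, h2] at h
  omega

/-- Apart from `1`, the star with centre `c`, the isolated vertices of the neighbourhood of `u` and
the edges leaving that neighbourhood contribute less than `1` to `m - (ρ² - ρ)`. -/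
def IsTight (G : SimpleGraph V) [DecidableRel G.Adj] (u c : V) (x : V → ℝ) : Prop :=
  ((leaves G u c).card - 1 : ℝ) * (1 - x c) + ∑ v ∈ isoSet G u, x v + crossCost G u x < 1

theorem IsPeakVector.four_le_card_leaves (h : IsPeakVector G ρ x u) (hs : IsSingleStar G u c)
    (ht : IsTight G u c x) (hρ : 5 < ρ) : 4 ≤ (leaves G u c).card := by
  have hsum := h.sum_near
  rw [hs.sum_near] at hsum
  have h1 : ∑ v ∈ leaves G u c, x v ≤ (leaves G u c).card := by
    rw [Finset.card_eq_sum_ones, Nat.cast_sum]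
    exact Finset.sum_le_sum fun v _ => by simpa using h.le_one v
  have h2 : (1 : ℝ) ≤ (leaves G u c).card := by exact_mod_cast hs.center.one_le_degIn
  have h3 : 0 ≤ ((leaves G u c).card - 1 : ℝ) * (1 - x c) :=
    mul_nonneg (by linarith) (by linarith [h.le_one c])
  have he : 0 ≤ crossCost G u x := crossCost_nonneg h.le_one
  have hc := h.le_one c
  unfold IsTight at ht
  have h4 : ((3 : ℕ) : ℝ) < (leaves G u c).card := by push_cast; linarith
  exact_mod_cast h4

theorem IsPeakVector.crossCost_term_le (h : IsPeakVector G ρ x u) {w : V} (hw : w ∈ far G u) :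
    (degIn G (near G u) w : ℝ) * (1 - x w) ≤ crossCost G u x :=
  Finset.single_le_sum (f := fun w => (degIn G (near G u) w : ℝ) * (1 - x w))
    (fun w _ => mul_nonneg (Nat.cast_nonneg _) (by linarith [h.le_one w])) hw

/-- All vertices far from the peak have small entries. For a far vertex `w` not adjacent to `c`, the
product `d(w) (1 - x w)` is below `1`, where `ρ² x w ≤ 3 d(w)` and `d(w) ≤ ρ`; this forces
`d(w) ≤ 1`. -/
theorem IsPeakVector.far_le (h : IsPeakVector G ρ x u) (hgem : gemGraph.Free G)
    (hs : IsSingleStar G u c) (ht : IsTight G u c x) (hρ : 5 < ρ) (hfar : farEdges G u < 1)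
    {w : V} (hw : w ∈ far G u) : x w ≤ 2 / 5 := by
  have hr := h.four_le_card_leaves hs ht hρ
  have hb : 0 ≤ ∑ v ∈ isoSet G u, x v := Finset.sum_nonneg fun v _ => h.nonneg v
  have he : 0 ≤ crossCost G u x := crossCost_nonneg h.le_one
  have hc1 := h.le_one c
  have hr' : (4 : ℝ) ≤ (leaves G u c).card := by exact_mod_cast hr
  have h3 : 3 * (1 - x c) ≤ ((leaves G u c).card - 1 : ℝ) * (1 - x c) :=
    mul_le_mul_of_nonneg_right (by linarith) (by linarith)
  unfold IsTight at ht
  have hec : crossCost G u x ≤ x c := by linarith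
  have hcpos : 0 < x c := by linarith
  -- A far neighbour of the centre sees no leaf: the centre's neighbourhood would contain a path.
  have hadj : ∀ w ∈ far G u, G.Adj c w → x w ≤ 2 / 5 := by
    intro w hw hcw
    obtain ⟨hwu, hnw⟩ := mem_far.1 hw
    have hno : ∀ l ∈ leaves G u c, ¬ G.Adj w l := by
      intro l hl hwl
      obtain ⟨l', hl', hne⟩ := Finset.exists_mem_ne (s := leaves G u c) (by omega) l
      rw [mem_leaves] at hl hl'
      refine not_path_in_neighborhood hgem hcw hl.2 hs.center.adj.symm hl'.2 hwl hl.1.symm hl'.1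
        hwu hne.symm ?_
      rintro rfl
      exact hnw hl'.1
    have h1 := h.eig_far hfar hw
    rw [hs.sum_near, Finset.sum_eq_zero fun l hl => if_neg (hno l hl), add_zero,
      if_pos hcw.symm] at h1
    have h2 : ∑ v ∈ isoSet G u, (if G.Adj w v then x v else 0) ≤ ∑ v ∈ isoSet G u, x v := by
      refine Finset.sum_le_sum fun v _ => ?_
      split_ifs
      · exact le_rfl
      · exact h.nonneg v
    have h4 : 5 * x w ≤ ρ * x w := mul_le_mul_of_nonneg_right hρ.le (h.nonneg w)
    linarith
  have hgap : ∀ w ∈ far G u, ¬ G.Adj c w → x c ≤ ρ * (1 - x w) := by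
    intro w hw hcw
    have h1 := h.sum_le_gap hfar hw (S := {c}) (by
      intro v hv
      rw [Finset.mem_singleton] at hv
      subst hv
      exact ⟨hs.center.adj, fun h => hcw h.symm⟩)
    simpa using h1
  -- The entries far from the peak sum to at most `1`.
  have hsumfar : ∑ w ∈ far G u, x w ≤ 1 := by
    have h1 : (∑ w ∈ far G u, x w) * x c ≤ crossCost G u x := by
      rw [Finset.sum_mul]
      refine Finset.sum_le_sum fun w hw => ?_
      have hw0 := h.nonneg w
      by_cases hcw : G.Adj c w
      · have h2 := hadj w hw hcw
        have h3 : 1 ≤ degIn G (near G u) w :=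
          Finset.card_pos.2 ⟨c, Finset.mem_filter.2 ⟨mem_near.2 hs.center.adj, hcw.symm⟩⟩
        have h3' : (1 : ℝ) ≤ degIn G (near G u) w := by exact_mod_cast h3
        have h5 : 1 * (1 - x w) ≤ (degIn G (near G u) w : ℝ) * (1 - x w) :=
          mul_le_mul_of_nonneg_right h3' (by linarith)
        have h6 : x w * x c ≤ x w := mul_le_of_le_one_right hw0 hc1
        linarith
      · have h5 : ρ * x w * (1 - x w) ≤ degIn G (near G u) w * (1 - x w) :=
          mul_le_mul_of_nonneg_right (h.mul_far_le_degIn hfar hw) (by linarith [h.le_one w])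
        have h6 : x w * x c ≤ x w * (ρ * (1 - x w)) :=
          mul_le_mul_of_nonneg_left (hgap w hw hcw) hw0
        linarith
    by_contra hcon
    push Not at hcon
    have : 1 * x c < (∑ w ∈ far G u, x w) * x c := mul_lt_mul_of_pos_right hcon hcpos
    linarith
  have hleaf : ∀ v ∈ near G u, v ≠ c → ρ * x v ≤ 3 := by
    intro v hv hvc
    have hd : degIn G (near G u) v ≤ 1 := by
      rcases hs.mem_near_iff.1 (mem_near.1 hv) with hv | hv | hv
      · exact absurd hv hvc
      · rw [mem_leaves] at hv
        rw [hs.center.degIn_leaf hv.1 hv.2]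
      · rw [degIn_near_of_mem_isoSet hv]; exact Nat.zero_le _
    have hd' : (degIn G (near G u) v : ℝ) ≤ 1 := by exact_mod_cast hd
    have h1 := sum_adj_le_degIn (G := G) (near G u) v h.le_one
    have h2 : ∑ w ∈ far G u, (if G.Adj v w then x w else 0) ≤ ∑ w ∈ far G u, x w := by
      refine Finset.sum_le_sum fun v _ => ?_
      split_ifs
      · exact le_rfl
      · exact h.nonneg v
    rw [h.eig_split, if_pos (mem_near.1 hv).symm]
    linarith
  by_cases hcw : G.Adj c w
  · exact hadj w hw hcw
  set d := degIn G (near G u) w with hd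
  have hterm := h.crossCost_term_le hw
  rw [← hd] at hterm
  have hquad : ρ * (ρ * x w) ≤ 3 * d := by
    rw [h.eig_far hfar hw, Finset.mul_sum, hd, cast_degIn, Finset.mul_sum]
    refine Finset.sum_le_sum fun v hv => ?_
    split_ifs with hwv
    · rw [mul_one]
      exact hleaf v hv fun h => hcw (h ▸ hwv.symm)
    · simp
  have hdρ : (d : ℝ) ≤ ρ := by
    have h1 : (d : ℝ) * x c ≤ d * (ρ * (1 - x w)) :=
      mul_le_mul_of_nonneg_left (hgap w hw hcw) (Nat.cast_nonneg _)
    have h2 : ρ * (d * (1 - x w)) ≤ ρ * x c :=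
      mul_le_mul_of_nonneg_left (by linarith) (by linarith)
    exact le_of_mul_le_mul_right (by linarith) hcpos
  have hd1 : d ≤ 1 := by
    by_contra hcon
    have hd2 : (2 : ℝ) ≤ d := by exact_mod_cast (by omega : 2 ≤ d)
    have h1 : (0 : ℝ) ≤ (d - 2) * (ρ - d) := mul_nonneg (by linarith) (by linarith)
    -- Multiply `d * (1 - x w) < 1` by `ρ ^ 2` and insert the bound on `ρ ^ 2 * x w`.
    have h2 : ρ ^ 2 * (d * (1 - x w)) < ρ ^ 2 * 1 :=
      mul_lt_mul_of_pos_left (by linarith) (by positivity)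
    have h4 : d * (ρ * (ρ * x w)) ≤ d * (3 * d) :=
      mul_le_mul_of_nonneg_left hquad (Nat.cast_nonneg _)
    have h5 : 0 < ρ ^ 2 - 3 * ρ - 6 := by nlinarith
    have h6 : 0 ≤ (ρ ^ 2 - 3 * ρ - 6) * (d - 2) := mul_nonneg h5.le (by linarith)
    nlinarith
  have hd1' : (d : ℝ) ≤ 1 := by exact_mod_cast hd1
  have h1 : 25 * x w ≤ ρ * ρ * x w := mul_le_mul_of_nonneg_right (by nlinarith) (h.nonneg w)
  linarith

/-- By the parity of the number of edges, every vertex is in the closed neighbourhood of the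
peak. -/
theorem IsPeakVector.far_eq_empty (h : IsPeakVector G ρ x u) (hgem : gemGraph.Free G)
    (hs : IsSingleStar G u c) (ht : IsTight G u c x) (hρ : 5 < ρ) (hfar : farEdges G u < 1)
    (hodd : Odd G.edgeSet.ncard) (hiso : ∀ v, ¬ G.IsIsolated v) : far G u = ∅ := by
  by_contra hne
  obtain ⟨w, hw⟩ := Finset.nonempty_iff_ne_empty.2 hne
  have hr := h.four_le_card_leaves hs ht hρ
  have hb : 0 ≤ ∑ v ∈ isoSet G u, x v := Finset.sum_nonneg fun v _ => h.nonneg v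
  have hr' : (4 : ℝ) ≤ (leaves G u c).card := by exact_mod_cast hr
  have h3 : 0 ≤ ((leaves G u c).card - 1 : ℝ) * (1 - x c) :=
    mul_nonneg (by linarith) (by linarith [h.le_one c])
  unfold IsTight at ht
  have hdw : 1 ≤ degIn G (near G u) w := by
    have : ∃ v, G.Adj w v := by
      by_contra hcon
      push Not at hcon
      exact hiso w (by simpa [SimpleGraph.IsIsolated] using hcon)
    obtain ⟨v, hwv⟩ := this
    refine Finset.card_pos.2 ⟨v, Finset.mem_filter.2 ⟨?_, hwv⟩⟩
    by_contra hv
    rw [mem_near] at hv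
    by_cases hvu : v = u
    · subst hvu; exact (mem_far.1 hw).2 hwv.symm
    · exact not_adj_of_farEdges_lt_one hfar hw (mem_far.2 ⟨hvu, hv⟩) hwv
  have hcost : (3 / 5) * ∑ w ∈ far G u, (degIn G (near G u) w : ℝ) ≤ crossCost G u x := by
    rw [crossCost, Finset.mul_sum]
    refine Finset.sum_le_sum fun w hw => ?_
    have h1 := h.far_le hgem hs ht hρ hfar hw
    rw [mul_comm]
    exact mul_le_mul_of_nonneg_left (by linarith) (Nat.cast_nonneg _)
  have hle : ∑ w ∈ far G u, degIn G (near G u) w ≤ 1 := by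
    have : ((∑ w ∈ far G u, degIn G (near G u) w : ℕ) : ℝ) < (2 : ℕ) := by
      push_cast; linarith
    exact Nat.lt_succ_iff.1 (by exact_mod_cast this)
  have hge := Finset.single_le_sum (f := fun w => degIn G (near G u) w)
    (fun w _ => Nat.zero_le _) hw
  have hcard := hs.card_edges hfar
  -- Exactly one edge joins `w` to the neighbourhood of `u`; parity yields an isolated vertex there.
  have hI : (isoSet G u).Nonempty := by
    rw [← Finset.card_pos]
    obtain ⟨k, hk⟩ := hodd
    omega
  obtain ⟨i, hi⟩ := hI
  have hbi : x i ≤ ∑ v ∈ isoSet G u, x v := Finset.single_le_sum (fun v _ => h.nonneg v) hi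
  have hxi : 1 ≤ ρ * x i := by
    rw [h.eig_split, if_pos (mem_isoSet.1 hi).1.symm, add_assoc]
    refine le_add_of_nonneg_right (add_nonneg ?_ ?_) <;>
    · refine Finset.sum_nonneg fun v _ => ?_
      split_ifs
      · exact h.nonneg v
      · exact le_rfl
  have hd1 : degIn G (near G u) w = 1 := by omega
  have hxw := h.mul_far_le_degIn hfar hw
  have hterm := h.crossCost_term_le hw
  rw [hd1, Nat.cast_one] at hxw hterm
  have : x w ≤ x i := le_of_mul_le_mul_left (hxw.trans hxi) (by linarith)
  linarith

/-- When nothing is far from the peak, the eigenvalue equations evaluate the extremal quartic at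
`ρ`. -/
theorem IsPeakVector.extremalQuartic_eq (h : IsPeakVector G ρ x u) (hs : IsSingleStar G u c)
    (hfar : far G u = ∅) :
    extremalQuartic G.edgeSet.ncard ρ
      = (2 - (isoSet G u).card) * (ρ + (leaves G u c).card - 1) := by
  have hfar' : farEdges G u < 1 := by simp [farEdges, hfar]
  have hm := hs.card_edges hfar'
  rw [hfar, Finset.sum_empty, add_zero] at hm
  have hm' : (G.edgeSet.ncard : ℝ) = 1 + 2 * (leaves G u c).card + (isoSet G u).card := by
    exact_mod_cast hm
  have heig : ∀ v ∈ near G u,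
      ρ * x v = 1 + ∑ w ∈ (near G u).filter (G.Adj v), x w := by
    intro v hv
    rw [h.eig_split, if_pos (mem_near.1 hv).symm, hfar, Finset.sum_empty, add_zero,
      Finset.sum_filter]
  have hI : ∀ i ∈ isoSet G u, ρ * x i = 1 := by
    intro i hi
    have h0 := degIn_near_of_mem_isoSet hi
    rw [degIn, Finset.card_eq_zero] at h0
    rw [heig i (mem_near.2 (mem_isoSet.1 hi).1), h0, Finset.sum_empty, add_zero]
  have hL : ∀ l ∈ leaves G u c, ρ * x l = 1 + x c := by
    intro l hl
    obtain ⟨h1, h2⟩ := mem_leaves.1 hl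
    have : (near G u).filter (G.Adj l) = {c} := by
      ext w
      rw [Finset.mem_filter, mem_near, Finset.mem_singleton]
      exact ⟨fun hw => hs.center.leaf l h1 h2 w hw.1 hw.2,
        fun hw => by subst hw; exact ⟨hs.center.adj, h2.symm⟩⟩
    rw [heig l (mem_near.2 h1), this, Finset.sum_singleton]
  have hLsum : ρ * ∑ l ∈ leaves G u c, x l = (leaves G u c).card * (1 + x c) := by
    rw [Finset.mul_sum, Finset.sum_congr rfl hL, Finset.sum_const, nsmul_eq_mul]
  have hIsum : ρ * ∑ i ∈ isoSet G u, x i = (isoSet G u).card := by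
    rw [Finset.mul_sum, Finset.sum_congr rfl hI, Finset.sum_const, nsmul_eq_mul, mul_one]
  have hc : ρ * x c = 1 + ∑ l ∈ leaves G u c, x l := heig c (mem_near.2 hs.center.adj)
  have hsum := h.sum_near
  rw [hs.sum_near] at hsum
  set r := ((leaves G u c).card : ℝ)
  set s := ((isoSet G u).card : ℝ)
  have e1 : (ρ ^ 2 - r) * x c = ρ + r := by
    linear_combination ρ * hc + hLsum
  have e2 : (ρ + r) * x c = ρ ^ 2 - r - s := by
    linear_combination ρ * hsum - hLsum - hIsum
  rw [hm']
  unfold extremalQuartic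
  linear_combination (ρ + r) * e1 - (ρ ^ 2 - r) * e2

/-! ### Recognizing the two extremal graphs -/

theorem IsSingleStar.eq_or_mem (hs : IsSingleStar G u c) (hfar : far G u = ∅) (v : V) :
    v = u ∨ v = c ∨ v ∈ leaves G u c ∨ v ∈ isoSet G u := by
  by_cases hv : v = u
  · exact Or.inl hv
  · refine Or.inr (hs.mem_near_iff.1 ?_)
    by_contra hadj
    have : v ∈ far G u := mem_far.2 ⟨hv, hadj⟩
    simp [hfar] at this

omit [DecidableEq V] in
theorem IsStarCenter.not_adj_leaves (hc : IsStarCenter G u c) {l l' : V}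
    (hl : l ∈ leaves G u c) (hl' : l' ∈ leaves G u c) : ¬ G.Adj l l' := by
  rw [mem_leaves] at hl hl'
  intro hadj
  exact hl'.2.ne (hc.leaf l hl.1 hl.2 l' hl'.1 hadj).symm

theorem IsSingleStar.nonempty_iso_splitGraph (hs : IsSingleStar G u c) (hfar : far G u = ∅)
    {n : ℕ} (hL : (leaves G u c).card = n - 2) (hI : isoSet G u = ∅) :
    Nonempty (G ≃g splitGraph n 2) := by
  let eL := ((leaves G u c).equivFinOfCardEq hL).symm
  have hmL : ∀ i, G.Adj u (eL i) ∧ G.Adj c (eL i) := fun i => mem_leaves.1 (eL i).2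
  have hLL : ∀ i j, ¬ G.Adj (eL i) (eL j) := fun i j =>
    hs.center.not_adj_leaves (eL i).2 (eL j).2
  have huc := hs.center.adj
  let φ : Fin 2 ⊕ Fin (n - 2) → V := Sum.elim ![u, c] fun i => (eL i : V)
  have hadj : ∀ a b, G.Adj (φ a) (φ b) ↔ (splitGraph n 2).Adj a b := by
    intro a b
    rw [splitGraph_adj]
    rcases a with a | a <;> rcases b with b | b
    · fin_cases a <;> fin_cases b <;> simp [φ, huc, huc.symm]
    · fin_cases a <;> simp [φ, hmL]
    · fin_cases b <;> simp [φ, hmL, G.adj_comm (eL a)]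
    · simp [φ, hLL]
  have hinj : Function.Injective φ := by
    rintro (a | a) (b | b) hab
    · fin_cases a <;> fin_cases b <;> simp [φ, huc.ne, huc.ne'] at hab ⊢
    · exact absurd hab (G.ne_of_adj ((hadj _ _).2 ((splitGraph_adj _ _).2 trivial)))
    · exact absurd hab (G.ne_of_adj ((hadj _ _).2 ((splitGraph_adj _ _).2 trivial)))
    · simpa [φ, Subtype.val_inj] using hab
  have hsurj : Function.Surjective φ := by
    intro v
    rcases hs.eq_or_mem hfar v with rfl | rfl | hv | hv
    · exact ⟨Sum.inl 0, rfl⟩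
    · exact ⟨Sum.inl 1, rfl⟩
    · exact ⟨Sum.inr (eL.symm ⟨v, hv⟩), by simp [φ]⟩
    · simp [hI] at hv
  exact ⟨(⟨Equiv.ofBijective φ ⟨hinj, hsurj⟩, fun {a b} => hadj a b⟩ : splitGraph n 2 ≃g G).symm⟩

theorem IsSingleStar.nonempty_iso_splitGraphPendant (hs : IsSingleStar G u c)
    (hfar : far G u = ∅) {n t : ℕ} (hL : (leaves G u c).card = n - t - 2)
    (hI : (isoSet G u).card = t) : Nonempty (G ≃g splitGraphPendant n 2 t) := by
  let eL := ((leaves G u c).equivFinOfCardEq hL).symm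
  let eI := ((isoSet G u).equivFinOfCardEq hI).symm
  have hmL : ∀ i, G.Adj u (eL i) ∧ G.Adj c (eL i) := fun i => mem_leaves.1 (eL i).2
  have hLL : ∀ i j, ¬ G.Adj (eL i) (eL j) := fun i j =>
    hs.center.not_adj_leaves (eL i).2 (eL j).2
  have huI : ∀ i, G.Adj u (eI i) := fun i => (mem_isoSet.1 (eI i).2).1
  have hI' : ∀ i v, G.Adj u v → ¬ G.Adj (eI i) v := fun i => (mem_isoSet.1 (eI i).2).2
  have hII : ∀ i j, ¬ G.Adj (eI i) (eI j) := fun i j => hI' i _ (huI j)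
  have hIL : ∀ i j, ¬ G.Adj (eI i) (eL j) := fun i j => hI' i _ (hmL j).1
  have huc := hs.center.adj
  have hIc : ∀ i, ¬ G.Adj (eI i) c := fun i => hI' i _ huc
  let φ : (Fin 2 ⊕ Fin (n - t - 2)) ⊕ Fin t → V :=
    Sum.elim (Sum.elim ![u, c] fun i => (eL i : V)) fun i => (eI i : V)
  have hadj : ∀ a b, G.Adj (φ a) (φ b) ↔ (splitGraphPendant n 2 t).Adj a b := by
    intro a b
    rw [splitGraphPendant_adj]
    rcases a with (a | a) | a <;> rcases b with (b | b) | b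
    · fin_cases a <;> fin_cases b <;> simp [φ, huc, huc.symm]
    · fin_cases a <;> simp [φ, hmL]
    · fin_cases a <;> simp [φ, huI, hIc, G.adj_comm c]
    · fin_cases b <;> simp [φ, hmL, G.adj_comm (eL a)]
    · simp [φ, hLL]
    · simp [φ, hIL, G.adj_comm (eL a)]
    · fin_cases b <;> simp [φ, huI, hIc, G.adj_comm (eI a) u]
    · simp [φ, hIL]
    · simp [φ, hII]
  have hcL : ∀ i, c ≠ eL i := fun i => (hmL i).2.ne
  have huL : ∀ i, u ≠ eL i := fun i => (hmL i).1.ne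
  have hcI : ∀ i, c ≠ eI i := fun i h => by
    obtain ⟨l, hul, hcl⟩ := hs.center.exists_leaf
    exact hI' i l hul (h ▸ hcl)
  have hneI : ∀ i, u ≠ eI i := fun i => (huI i).ne
  have hLI : ∀ i j, (eL i : V) ≠ eI j := fun i j h => hIc j (h ▸ (hmL i).2.symm)
  have hinj : Function.Injective φ := by
    rintro ((a | a) | a) ((b | b) | b) hab
    · fin_cases a <;> fin_cases b <;> simp [φ, huc.ne, huc.ne'] at hab ⊢
    · fin_cases a <;> simp [φ, huL, hcL] at hab
    · fin_cases a <;> simp [φ, hneI, hcI] at hab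
    · fin_cases b <;> simp [φ, (huL _).symm, (hcL _).symm] at hab
    · simpa [φ, Subtype.val_inj] using hab
    · exact absurd hab (hLI _ _)
    · fin_cases b <;> simp [φ, (hneI _).symm, (hcI _).symm] at hab
    · exact absurd hab (hLI _ _).symm
    · simpa [φ, Subtype.val_inj] using hab
  have hsurj : Function.Surjective φ := by
    intro v
    rcases hs.eq_or_mem hfar v with rfl | rfl | hv | hv
    · exact ⟨Sum.inl (Sum.inl 0), rfl⟩
    · exact ⟨Sum.inl (Sum.inl 1), rfl⟩
    · exact ⟨Sum.inl (Sum.inr (eL.symm ⟨v, hv⟩)), by simp [φ]⟩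
    · exact ⟨Sum.inr (eI.symm ⟨v, hv⟩), by simp [φ]⟩
  exact ⟨(⟨Equiv.ofBijective φ ⟨hinj, hsurj⟩, fun {a b} => hadj a b⟩ :
    splitGraphPendant n 2 t ≃g G).symm⟩

end Peak

/-! ### The extremal graph -/

/-- A graph as in the theorem whose spectral radius reaches that of `S_{(m+5)/2,2}^2` is
isomorphic to it. -/
theorem nonempty_iso_of_le_graphSpectralRadius {V : Type*} [Fintype V] (G : SimpleGraph V) (m : ℕ)
    (hm : 23 ≤ m) (hodd : Odd m) (hedges : G.edgeSet.ncard = m)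
    (hisolated : ∀ v : V, ¬ G.IsIsolated v) (hgem : gemGraph.Free G)
    (hne : ¬ Nonempty (G ≃g splitGraph ((m + 3) / 2) 2))
    (hle : graphSpectralRadius (splitGraphPendant ((m + 5) / 2) 2 2) ≤ graphSpectralRadius G) :
    Nonempty (G ≃g splitGraphPendant ((m + 5) / 2) 2 2) := by
  classical
  have hV : Nonempty V := by
    by_contra hV
    rw [not_nonempty_iff] at hV
    have : G.edgeSet = ∅ := by
      rw [SimpleGraph.edgeSet_eq_empty]; exact Subsingleton.elim _ _
    rw [this, Set.ncard_empty] at hedges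
    omega
  have hm' : (23 : ℝ) ≤ m := by exact_mod_cast hm
  obtain ⟨l, hl5, hl, hl0⟩ := exists_root_extremalQuartic hm'
  have hlρ : l ≤ graphSpectralRadius G := by
    obtain ⟨k, hk⟩ := hodd
    exact (root_le_graphSpectralRadius_splitGraphPendant (r := k - 1) (by omega) hl5 hl hl0).trans
      hle
  obtain ⟨x, u, h⟩ := exists_isPeakVector G
  set ρ := graphSpectralRadius G
  have hρ : 5 < ρ := by linarith
  have hdef := h.deficit
  have hsmall : (m : ℝ) - (ρ ^ 2 - ρ) < 2 := by nlinarith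
  rw [hedges, sum_charge_near hgem] at hdef
  have hR := isStarUnion_starSet (u := u) hgem
  have ha : 0 ≤ ∑ v ∈ triSet G u, (1 - x v) :=
    Finset.sum_nonneg fun v _ => by linarith [h.le_one v]
  have hb : 0 ≤ ∑ v ∈ isoSet G u, x v := Finset.sum_nonneg fun v _ => h.nonneg v
  have hc : 0 ≤ farEdges G u := farEdges_nonneg
  have he : 0 ≤ crossCost G u x := crossCost_nonneg h.le_one
  rcases hR.eq_empty_or_eq_starAt hgem h.le_one (by linarith) with hS | ⟨c, hcc, hS⟩
  · rw [hS, Finset.sum_empty] at hdef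
    exact absurd hS (h.starSet_ne_empty hgem hρ (by linarith))
  have h1 := hcc.one_le_sum_charge h.le_one
  have h2 := hcc.sum_charge (x := x)
  rw [hS] at hdef
  have hfar : farEdges G u < 1 := by linarith
  have hT := h.triSet_eq_empty hgem hρ hfar (by linarith)
  have hs : IsSingleStar G u c := ⟨hcc, hT, hS⟩
  have ht : IsTight G u c x := by
    rw [IsTight, card_leaves]
    linarith
  have hfar0 := h.far_eq_empty hgem hs ht hρ hfar (hedges ▸ hodd) hisolated
  have hcard := hs.card_edges hfar
  rw [hfar0, Finset.sum_empty, add_zero, hedges] at hcard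
  have hquart := h.extremalQuartic_eq hs hfar0
  rw [hedges] at hquart
  have hq0 := extremalQuartic_nonneg_of_root_le hm' hl5 hl hl0 hlρ
  have hcard_le : (isoSet G u).card ≤ 2 := by
    by_contra hcon
    have h3 : (3 : ℝ) ≤ (isoSet G u).card := by exact_mod_cast (by omega : 3 ≤ (isoSet G u).card)
    have h4 : (0 : ℝ) ≤ (leaves G u c).card := Nat.cast_nonneg _
    rw [hquart] at hq0
    have : (2 - (isoSet G u).card : ℝ) * (ρ + (leaves G u c).card - 1) < 0 :=
      mul_neg_of_neg_of_pos (by linarith) (by linarith)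
    linarith
  obtain ⟨k, hk⟩ := hodd
  have hcases : (isoSet G u).card = 0 ∨ (isoSet G u).card = 2 := by omega
  rcases hcases with hI | hI
  · exact absurd (hs.nonempty_iso_splitGraph hfar0 (by omega) (Finset.card_eq_zero.1 hI)) hne
  · exact hs.nonempty_iso_splitGraphPendant hfar0 (by omega) hI

theorem theorem1p2 {V : Type*} [Fintype V] (G : SimpleGraph V) (m : ℕ)
    (hm : 23 ≤ m) (hodd : Odd m)
    (hedges : G.edgeSet.ncard = m)
    (hisolated : ∀ v : V, ¬ G.IsIsolated v)
    (hgem : gemGraph.Free G)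
    (hne : ¬ Nonempty (G ≃g splitGraph ((m + 3) / 2) 2)) :
    graphSpectralRadius G ≤ graphSpectralRadius (splitGraphPendant ((m + 5) / 2) 2 2) ∧
      (graphSpectralRadius G = graphSpectralRadius (splitGraphPendant ((m + 5) / 2) 2 2) ↔
        Nonempty (G ≃g splitGraphPendant ((m + 5) / 2) 2 2)) := by
  have key := nonempty_iso_of_le_graphSpectralRadius G m hm hodd hedges hisolated hgem hne
  refine ⟨?_, fun h => key h.ge, fun ⟨f⟩ => graphSpectralRadius_eq_of_iso f⟩
  by_contra hlt
  obtain ⟨f⟩ := key (not_le.1 hlt).le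
  exact hlt (graphSpectralRadius_eq_of_iso f).le
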